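/- Let $\Omega\subset\mathbb{R}^2$ be a bounded simply connected domain, let $e_1,e_2$ be the canonical basis of $\mathbb{R}^2$, and put $\epsilon_1=(\tfrac1{\sqrt2},\tfrac1{\sqrt2})$, $\epsilon_2=(-\tfrac1{\sqrt2},\tfrac1{\sqrt2})$. For $u\in W^{1,\infty}(\Omega)$ and orthonormal $\xi,\eta$, write $u_\xi=\nabla u\cdot\xi$, $u_\eta=\nabla u\cdot\eta$ and $$\Sigma_{\xi\eta}u=u_\xi\Big(1-u_\eta^2-\tfrac13u_\xi^2\Big)\xi-u_\eta\Big(1-u_\xi^2-\tfrac13u_\eta^2\Big)\eta .$$ Let $E(\Omega)$ be the set of all $u\in W^{1,\infty}(\Omega)$ such that $|\nabla u|=1$ a.e. in $\Omega$ and $\nabla\cdot(\Sigma_{e_1e_2}u)=0$, $\nabla\cdot(\Sigma_{\epsilon_1\epsilon_2}u)=0$ in the sense of distributions in $\Omega$. Theorem. Let $u\in E(\Omega)$, let $w=\nabla u^\perp=(-u_{,2},u_{,1})$, and let $\xi\in\mathbb{S}^1\setminus\{e_1,-e_1,e_2,-e_2\}$. Define $\Phi^\xi(z)=|z|^2\xi$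 if $z\cdot\xi>0$ and $\Phi^\xi(z)=0$ if $z\cdot\xi\le0$; and define $\chi(x,\xi)=1$ if $w(x)\cdot\xi>0$ and $\chi(x,\xi)=0$ if $w(x)\cdot\xi\le0$. Then $$\nabla\cdot\big[\Phi^\xi(w)\big]=0\quad\text{in the sense of distributions in }\Omega,$$ and, equivalently (since $|w|=1$ a.e.), $$\xi\cdot\nabla\chi(\cdot,\xi)=0\quad\text{in the sense of distributions in }\Omega .$$ -/

import Mathlib

open MeasureTheory
open scoped Distributions RealInnerProductSpace ENNReal

noncomputable section

namespace EikonalEntropy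

/-- The Euclidean plane. -/
abbrev Plane : Type := EuclideanSpace ℝ (Fin 2)

/-- The canonical basis vectors `e₁ = (1,0)`, `e₂ = (0,1)`. -/
def e₁ : Plane := !₂[1, 0]

def e₂ : Plane := !₂[0, 1]

/-- The canonical basis rotated anticlockwise by `π/4`. -/
def ε₁ : Plane := !₂[1 / Real.sqrt 2, 1 / Real.sqrt 2]

def ε₂ : Plane := !₂[-(1 / Real.sqrt 2), 1 / Real.sqrt 2]

/-- Anticlockwise rotation by `π/2`: `z^⊥ = (-z₂, z₁)`. -/
def perp (z : Plane) : Plane := !₂[-z 1, z 0]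

/-- `g` is the weak gradient of `u` in `Ω`; both are locally integrable in `Ω`.
Here `𝓓(Ω, ℝ)` is the space of smooth functions with compact support contained in `Ω`, and
`fderiv ℝ ζ x v` is the derivative of `ζ` at `x` in the direction `v`, so that the identity
says `∫_Ω u (v · ∇ζ) = - ∫_Ω (g · v) ζ`. -/
def IsWeakGradient (Ω : TopologicalSpace.Opens Plane) (u : Plane → ℝ) (g : Plane → Plane) :
    Prop :=
  LocallyIntegrableOn u (Ω : Set Plane) ∧ LocallyIntegrableOn g (Ω : Set Plane) ∧
    ∀ (ζ : 𝓓(Ω, ℝ)) (v : Plane),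
      ∫ x in (Ω : Set Plane), u x * fderiv ℝ ζ x v = -∫ x in (Ω : Set Plane), ⟪g x, v⟫ * ζ x

/-- `∇ · V = 0` in the sense of distributions in `Ω`, for a locally integrable vector field `V`:
`∫_Ω V · ∇ζ = 0` for every test function `ζ`. -/
def IsDivergenceFree (Ω : TopologicalSpace.Opens Plane) (V : Plane → Plane) : Prop :=
  LocallyIntegrableOn V (Ω : Set Plane) ∧
    ∀ ζ : 𝓓(Ω, ℝ), ∫ x in (Ω : Set Plane), fderiv ℝ ζ x (V x) = 0

/-- `ξ · ∇f = 0` in the sense of distributions in `Ω`, for a locally integrable function `f`: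
`∫_Ω f (ξ · ∇ζ) = 0` for every test function `ζ`. -/
def IsConstantAlong (Ω : TopologicalSpace.Opens Plane) (ξ : Plane) (f : Plane → ℝ) : Prop :=
  LocallyIntegrableOn f (Ω : Set Plane) ∧
    ∀ ζ : 𝓓(Ω, ℝ), ∫ x in (Ω : Set Plane), f x * fderiv ℝ ζ x ξ = 0

/-- The vector `Σ_{ξη}u` as a function of the value `p` of the gradient of `u`, so that
`u_ξ = p · ξ` and `u_η = p · η`:
`u_ξ (1 - u_η² - u_ξ²/3) ξ - u_η (1 - u_ξ² - u_η²/3) η`. -/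
def entropySigma (ξ η p : Plane) : Plane :=
  (⟪p, ξ⟫ * (1 - ⟪p, η⟫ ^ 2 - ⟪p, ξ⟫ ^ 2 / 3)) • ξ -
    (⟪p, η⟫ * (1 - ⟪p, ξ⟫ ^ 2 - ⟪p, η⟫ ^ 2 / 3)) • η

/-- The class `E(Ω)` of all `u ∈ W^{1,∞}(Ω)` with `|∇u| = 1` a.e. in `Ω` whose two vector fields
`Σ_{e₁e₂}u` and `Σ_{ε₁ε₂}u` are divergence free in the sense of distributions. -/
def E (Ω : TopologicalSpace.Opens Plane) : Set (Plane → ℝ) :=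
  {u | MemLp u ∞ (volume.restrict (Ω : Set Plane)) ∧
    ∃ g : Plane → Plane, IsWeakGradient Ω u g ∧
      MemLp g ∞ (volume.restrict (Ω : Set Plane)) ∧
      (∀ᵐ x ∂(volume.restrict (Ω : Set Plane)), ‖g x‖ = 1) ∧
      IsDivergenceFree Ω (fun x => entropySigma e₁ e₂ (g x)) ∧
      IsDivergenceFree Ω (fun x => entropySigma ε₁ ε₂ (g x))}

/-- `Φ^ξ(z) = |z|² ξ` if `z · ξ > 0`, and `0` otherwise. -/
def Φ (ξ z : Plane) : Plane :=
  if 0 < ⟪z, ξ⟫ then ‖z‖ ^ 2 • ξ else 0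

/-- The kinetic function of a vector field `m`: `χ(x,ξ) = 1` if `m(x) · ξ > 0`,
and `0` otherwise. -/
def χ (m : Plane → Plane) (x ξ : Plane) : ℝ :=
  if 0 < ⟪m x, ξ⟫ then 1 else 0

end EikonalEntropy

end

/-!
The gradient of `u` is written as a complex field `m` with `|m| = 1`. In the Wirtinger derivatives
`∂ = ∂/∂z` and `∂̄ = ∂/∂z̄`, the hypotheses say that `∂m` is real (`m` is curl free) and that
`3 ∂̄m + ∂m³ = 0` (`IsEikonal.integral_mode_two`): on the unit circle the two fields `Σ` are
multiples of `3 m̄ + m³` and `i (3 m̄ - m³)`. The equation `ξ · ∇χ(·, ξ) = 0` for all `ξ` has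
Fourier modes `(n + 1) ∂̄m^(n-1) + (n - 1) ∂m^(n+1) = 0`; the hypotheses are the modes
`n = 0, 2`, and all others have to be deduced from them. No chain rule is available for `m`, so two
facts about the mollifications `M` of `m` replace it.

*Regularity.* The determinant of the differences of the two fields `Σ` at two unit vectors is at
least a multiple of the fourth power of the distance of these vectors
(`two_mul_norm_pow_four_le_cross`). Both fields are divergence free, so that the determinant of
their finite differences is a divergence with a factor of order `|h|`
(`integral_mul_cross_shift_le`). Together this yields `‖m(· + h) - m‖_{L⁴} ≤ C |h|^{1/3}` locally
(`IsEikonal.exists_shift_bound`). The commutator `(1 - |M|²) ∂̄M` is cubic in the finite differences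
of `m` and costs one derivative, so it is locally bounded in `L^{4/3}`
(`IsEikonal.exists_commutator_bound`). It matters that the exponent `4/3` exceeds `1`.

*Factorization.* For smooth curl-free `M` the production of a suitable extension of the `n`-th
mode off the unit circle equals `M^(n-2) (1 - |M|²) ∂̄M` up to a constant
(`integral_entropy_identity`). The mode `n = 2` shows that the commutator tends to zero in the sense
of distributions. As it is bounded in `L^{4/3}` and `M^(n-2)` converges in `L⁴`, the product tends
to zero as well (`IsEikonal.tendsto_pow_mul_commutator`), which gives all modes.

The modes are finally combined into entropies whose profile is a polynomial in `s = w · ξ`, and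
uniform approximation followed by dominated convergence reaches the profile `max s 0`, whose entropy
is `Φ^ξ` (`IsEikonal.integral_indicator_along`). The pointwise limit is taken with profiles of
vanishing slope for `s ≤ 0`, so that the set `{w · ξ = 0}`, which may have positive measure, does
not contribute.
-/

noncomputable section

namespace EikonalEntropy

open Filter Topology Set
open scoped Convolution ContDiff ComplexConjugate

/-! ### Mollification -/

/-- The length parameter `1 / (n + 1)`. Mollification at stage `n` takes place at the cube of this
length, which keeps cube roots out of the estimates. -/
def scale (n : ℕ) : ℝ := 1 / ((n : ℝ) + 1)

theorem scale_pos (n : ℕ) : 0 < scale n := by unfold scale; positivity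

theorem tendsto_scale : Tendsto scale atTop (𝓝 0) := tendsto_one_div_add_atTop_nhds_zero_nat

/-- A smooth bump at the origin with inner and outer radii `scale n ^ 3` and `2 * scale n ^ 3`. -/
def bump (n : ℕ) : ContDiffBump (0 : Plane) where
  rIn := scale n ^ 3
  rOut := 2 * scale n ^ 3
  rIn_pos := pow_pos (scale_pos n) 3
  rIn_lt_rOut := by have := pow_pos (scale_pos n) 3; linarith

/-- The standard mollifier at scale `scale n ^ 3`. -/
def mollifier (n : ℕ) : Plane → ℝ := (bump n).normed volume

/-- The mollification of `g` at scale `scale n ^ 3`. -/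
def mollify (n : ℕ) (g : Plane → ℂ) : Plane → ℂ :=
  mollifier n ⋆[ContinuousLinearMap.lsmul ℝ ℝ, volume] g

theorem mollify_apply (n : ℕ) (g : Plane → ℂ) (x : Plane) :
    mollify n g x = ∫ t, mollifier n t • g (x - t) := rfl

theorem contDiff_mollifier (n : ℕ) : ContDiff ℝ ∞ (mollifier n) := (bump n).contDiff_normed

theorem mollifier_nonneg (n : ℕ) (x : Plane) : 0 ≤ mollifier n x := (bump n).nonneg_normed x

theorem integral_mollifier (n : ℕ) : ∫ x, mollifier n x = 1 := (bump n).integral_normed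

theorem integrable_mollifier (n : ℕ) : Integrable (mollifier n) := (bump n).integrable_normed

theorem hasCompactSupport_mollifier (n : ℕ) : HasCompactSupport (mollifier n) :=
  (bump n).hasCompactSupport_normed

theorem tsupport_mollifier (n : ℕ) :
    tsupport (mollifier n) = Metric.closedBall 0 (2 * scale n ^ 3) := (bump n).tsupport_normed_eq

theorem volume_real_closedBall (r : ℝ) (hr : 0 ≤ r) :
    volume.real (Metric.closedBall (0 : Plane) r)
      = r ^ 2 * volume.real (Metric.closedBall (0 : Plane) 1) := by
  have := Measure.addHaar_real_closedBall (μ := (volume : Measure Plane)) 0 hr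
  rw [this, Measure.addHaar_real_closedBall_eq_addHaar_real_ball]
  simp

theorem volume_real_unitBall_pos : 0 < volume.real (Metric.closedBall (0 : Plane) 1) :=
  ENNReal.toReal_pos (Metric.measure_closedBall_pos _ _ one_pos).ne'
    (measure_closedBall_lt_top).ne

theorem exists_mollifier_bounds : ∃ C : ℝ, 0 < C ∧ ∀ n : ℕ, ∀ x : Plane,
    mollifier n x ≤ C / scale n ^ 6 ∧ ‖fderiv ℝ (mollifier n) x‖ ≤ C / scale n ^ 9 := by
  set b : ContDiffBump (0 : Plane) := ⟨1, 2, one_pos, one_lt_two⟩ with hb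
  obtain ⟨D, hD⟩ := (b.contDiff (n := 1)).continuous_fderiv one_ne_zero
    |>.bounded_above_of_compact_support (b.hasCompactSupport.fderiv ℝ)
  have hD0 : 0 ≤ D := (norm_nonneg _).trans (hD 0)
  set v := volume.real (Metric.closedBall (0 : Plane) 1) with hv
  have hvpos : 0 < v := volume_real_unitBall_pos
  refine ⟨(D + 1) / v, by positivity, fun n x => ?_⟩
  have hs := scale_pos n
  have hball : volume.real (Metric.closedBall (0 : Plane) (bump n).rIn) = scale n ^ 6 * v := by
    rw [volume_real_closedBall _ (bump n).rIn_pos.le]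
    change (scale n ^ 3) ^ 2 * v = _
    ring
  have hmass : scale n ^ 6 * v ≤ ∫ x, bump n x := by
    rw [← hball]; exact (bump n).measure_closedBall_le_integral volume
  constructor
  · calc mollifier n x ≤ 1 / (scale n ^ 6 * v) := by
          rw [← hball]; exact (bump n).normed_le_div_measure_closedBall_rIn volume x
      _ ≤ (D + 1) / v / scale n ^ 6 := by
          rw [div_div, mul_comm v]; gcongr; linarith
  · have hscal : (mollifier n) = fun x => (∫ x, bump n x)⁻¹ * b ((scale n ^ 3)⁻¹ • x) := by
      funext y
      rw [mollifier, ContDiffBump.normed_def, div_eq_inv_mul]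
      congr 1
      rw [ContDiffBump.apply, ContDiffBump.apply]
      have h1 : (bump n).rOut / (bump n).rIn = b.rOut / b.rIn := by
        change 2 * scale n ^ 3 / scale n ^ 3 = 2 / 1
        field_simp
      rw [h1]
      congr 1
      simp [hb, bump]
    have hder : fderiv ℝ (mollifier n) x =
        (∫ x, bump n x)⁻¹ • ((scale n ^ 3)⁻¹ • fderiv ℝ b ((scale n ^ 3)⁻¹ • x)) := by
      rw [hscal, fderiv_const_mul, fderiv_comp_smul]
      exact ((b.contDiff (n := 1)).differentiable one_ne_zero).differentiableAt.comp x
        (by fun_prop)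
    have hpos : 0 < ∫ x, bump n x := (bump n).integral_pos
    have hpos' : 0 < scale n ^ 3 := by positivity
    rw [hder, norm_smul, norm_smul, Real.norm_of_nonneg (inv_pos.2 hpos).le,
      Real.norm_of_nonneg (inv_pos.2 hpos').le]
    calc (∫ x, bump n x)⁻¹ * ((scale n ^ 3)⁻¹ * ‖fderiv ℝ b ((scale n ^ 3)⁻¹ • x)‖)
        ≤ (scale n ^ 6 * v)⁻¹ * ((scale n ^ 3)⁻¹ * (D + 1)) := by
          gcongr
          linarith [hD ((scale n ^ 3)⁻¹ • x)]
      _ = (D + 1) / v / scale n ^ 9 := by field_simp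

theorem locallyIntegrable_of_bounded {g : Plane → ℂ} {C : ℝ} (hg : Measurable g)
    (hb : ∀ x, ‖g x‖ ≤ C) : LocallyIntegrable g := by
  refine (locallyIntegrable_const C).mono hg.aestronglyMeasurable (ae_of_all _ fun x => ?_)
  exact (hb x).trans (le_abs_self C)

theorem integrable_mollifier_smul {g : Plane → ℂ} {C : ℝ} (hg : Measurable g)
    (hb : ∀ x, ‖g x‖ ≤ C) (n : ℕ) (x : Plane) :
    Integrable fun t => mollifier n t • g (x - t) :=
  (integrable_mollifier n).smul_bdd C
    (hg.comp (measurable_const.sub measurable_id)).aestronglyMeasurable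
    (ae_of_all _ fun _ => hb _)

theorem contDiff_mollify {g : Plane → ℂ} {C : ℝ} (hg : Measurable g) (hb : ∀ x, ‖g x‖ ≤ C)
    (n : ℕ) : ContDiff ℝ ∞ (mollify n g) :=
  (hasCompactSupport_mollifier n).contDiff_convolution_left _ (contDiff_mollifier n)
    (locallyIntegrable_of_bounded hg hb)

theorem norm_mollify_le {g : Plane → ℂ} {C : ℝ} (hb : ∀ x, ‖g x‖ ≤ C)
    (n : ℕ) (x : Plane) : ‖mollify n g x‖ ≤ C := by
  rw [mollify_apply]
  calc ‖∫ t, mollifier n t • g (x - t)‖ ≤ ∫ t, mollifier n t * C := by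
        refine norm_integral_le_of_norm_le ((integrable_mollifier n).mul_const C)
          (ae_of_all _ fun t => ?_)
        rw [norm_smul, Real.norm_of_nonneg (mollifier_nonneg n t)]
        exact mul_le_mul_of_nonneg_left (hb _) (mollifier_nonneg n t)
    _ = C := by rw [integral_mul_const, integral_mollifier, one_mul]

theorem fderiv_mollify {g : Plane → ℂ} {C : ℝ} (hg : Measurable g) (hb : ∀ x, ‖g x‖ ≤ C)
    (n : ℕ) (x v : Plane) :
    fderiv ℝ (mollify n g) x v = ∫ t, fderiv ℝ (mollifier n) t v • g (x - t) := by
  have h := (hasCompactSupport_mollifier n).hasFDerivAt_convolution_left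
    (ContinuousLinearMap.lsmul ℝ ℝ) ((contDiff_mollifier n).of_le (by norm_cast))
    (locallyIntegrable_of_bounded hg hb) x
  have h' := h.fderiv
  rw [mollify, h', convolution_def, ContinuousLinearMap.integral_apply]
  · rfl
  · exact ((hasCompactSupport_mollifier n).fderiv ℝ).convolutionExists_left _
      ((contDiff_mollifier n).continuous_fderiv (by norm_num))
      (locallyIntegrable_of_bounded hg hb) x

theorem fderiv_mollify' {g : Plane → ℂ} {C : ℝ} (hg : Measurable g) (hb : ∀ x, ‖g x‖ ≤ C)
    (n : ℕ) (x v : Plane) :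
    fderiv ℝ (mollify n g) x v = ∫ t, fderiv ℝ (mollifier n) (x - t) v • g t := by
  rw [fderiv_mollify hg hb, ← integral_sub_left_eq_self _ _ x]
  simp

theorem ae_tendsto_mollify {g : Plane → ℂ} {C : ℝ} (hg : Measurable g) (hb : ∀ x, ‖g x‖ ≤ C) :
    ∀ᵐ x, Tendsto (fun n => mollify n g x) atTop (𝓝 (g x)) := by
  refine ContDiffBump.ae_convolution_tendsto_right_of_locallyIntegrable (K := 2) (φ := bump)
    ?_ (Eventually.of_forall fun n => le_rfl) (locallyIntegrable_of_bounded hg hb)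
  simpa [bump] using (tendsto_scale.pow 3).const_mul 2

/-! ### Test functions and divergence-free fields in complex notation -/

/-- Smooth functions with compact support contained in `U`. -/
structure IsTest {F : Type*} [NormedAddCommGroup F] [NormedSpace ℝ F] (U : Set Plane)
    (ζ : Plane → F) : Prop where
  contDiff : ContDiff ℝ ∞ ζ
  hasCompactSupport : HasCompactSupport ζ
  tsupport_subset : tsupport ζ ⊆ U

/-- The complex function `V`, read as the vector field `(Re V, Im V)`, is divergence free in `U` in
the sense of distributions. -/
def DivFree (U : Set Plane) (V : Plane → ℂ) : Prop :=
  ∀ ζ : Plane → ℝ, IsTest U ζ →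
    ∫ x, ((V x).re * fderiv ℝ ζ x e₁ + (V x).im * fderiv ℝ ζ x e₂) = 0

theorem plane_eq (h : Plane) : h = h 0 • e₁ + h 1 • e₂ := by
  ext i; fin_cases i <;> simp [e₁, e₂]

theorem norm_e₁ : ‖e₁‖ = 1 := by simp [e₁, EuclideanSpace.norm_eq]

theorem norm_e₂ : ‖e₂‖ = 1 := by simp [e₂, EuclideanSpace.norm_eq]

theorem abs_coord_le (h : Plane) (i : Fin 2) : |h i| ≤ ‖h‖ := PiLp.norm_apply_le h i

section Test

variable {F : Type*} [NormedAddCommGroup F] [NormedSpace ℝ F] {U : Set Plane} {ζ : Plane → F}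

theorem IsTest.differentiable (hζ : IsTest U ζ) : Differentiable ℝ ζ :=
  hζ.contDiff.differentiable (by norm_num)

theorem IsTest.continuous_fderiv (hζ : IsTest U ζ) (v : Plane) :
    Continuous fun x => fderiv ℝ ζ x v :=
  (hζ.contDiff.continuous_fderiv (by norm_num)).clm_apply continuous_const

theorem IsTest.hasCompactSupport_fderiv (hζ : IsTest U ζ) (v : Plane) :
    HasCompactSupport fun x => fderiv ℝ ζ x v :=
  hζ.hasCompactSupport.fderiv_apply ℝ v

theorem IsTest.fderiv_apply (hζ : IsTest U ζ) (v : Plane) :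
    IsTest U fun x => fderiv ℝ ζ x v where
  contDiff := (hζ.contDiff.fderiv_right (m := ∞) (by norm_cast)).clm_apply contDiff_const
  hasCompactSupport := hζ.hasCompactSupport_fderiv v
  tsupport_subset := (tsupport_fderiv_apply_subset ℝ v).trans hζ.tsupport_subset

end Test

theorem IsTest.mul {𝕜 : Type*} [RCLike 𝕜] {U : Set Plane} {ζ g : Plane → 𝕜} (hζ : IsTest U ζ)
    (hg : ContDiff ℝ ∞ g) : IsTest U fun x => ζ x * g x where
  contDiff := hζ.contDiff.mul hg
  hasCompactSupport := hζ.hasCompactSupport.mul_right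
  tsupport_subset := (tsupport_mul_subset_left (f := ζ) (g := g)).trans hζ.tsupport_subset

theorem integrable_mul_of_bounded {𝕜 : Type*} [RCLike 𝕜] {ζ F : Plane → 𝕜} {C : ℝ}
    (hζ : Continuous ζ) (hc : HasCompactSupport ζ) (hF : AEStronglyMeasurable F)
    (hb : ∀ x, ‖F x‖ ≤ C) : Integrable fun x => ζ x * F x :=
  (hζ.integrable_of_hasCompactSupport hc).mul_bdd (c := C) hF (ae_of_all _ hb)

theorem integrable_mul_of_bounded' {𝕜 : Type*} [RCLike 𝕜] {ζ F : Plane → 𝕜} {C : ℝ}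
    (hζ : Continuous ζ) (hc : HasCompactSupport ζ) (hF : AEStronglyMeasurable F)
    (hb : ∀ x, ‖F x‖ ≤ C) : Integrable fun x => F x * ζ x := by
  simpa only [mul_comm] using integrable_mul_of_bounded hζ hc hF hb

theorem integrable_divFree_integrand {U : Set Plane} {V : Plane → ℂ} {C : ℝ} (hV : Measurable V)
    (hb : ∀ x, ‖V x‖ ≤ C) {ζ : Plane → ℝ} (hζ : IsTest U ζ) :
    Integrable fun x => (V x).re * fderiv ℝ ζ x e₁ + (V x).im * fderiv ℝ ζ x e₂ :=
  (integrable_mul_of_bounded' (hζ.continuous_fderiv _) (hζ.hasCompactSupport_fderiv _)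
      (Complex.measurable_re.comp hV).aestronglyMeasurable
      fun x => (Complex.abs_re_le_norm _).trans (hb x)).add
    (integrable_mul_of_bounded' (hζ.continuous_fderiv _) (hζ.hasCompactSupport_fderiv _)
      (Complex.measurable_im.comp hV).aestronglyMeasurable
      fun x => (Complex.abs_im_le_norm _).trans (hb x))

theorem div_mollify_eq_zero {U : Set Plane} {V : Plane → ℂ} {C : ℝ} (hV : Measurable V)
    (hb : ∀ x, ‖V x‖ ≤ C) (hdiv : DivFree U V) {n : ℕ} {x : Plane}
    (hx : Metric.closedBall x (2 * scale n ^ 3) ⊆ U) :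
    (fderiv ℝ (mollify n V) x e₁).re + (fderiv ℝ (mollify n V) x e₂).im = 0 := by
  set ζ : Plane → ℝ := fun t => mollifier n (x - t) with hζdef
  have hsupp : tsupport ζ ⊆ Metric.closedBall x (2 * scale n ^ 3) := by
    refine closure_minimal (fun t ht => ?_) Metric.isClosed_closedBall
    have : x - t ∈ tsupport (mollifier n) := subset_tsupport _ ht
    rw [tsupport_mollifier] at this
    simpa [dist_eq_norm, norm_sub_rev] using this
  have hζ : IsTest U ζ :=
    ⟨(contDiff_mollifier n).comp (contDiff_const.sub contDiff_id),
      HasCompactSupport.of_support_subset_isCompact (isCompact_closedBall x (2 * scale n ^ 3))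
        ((subset_tsupport _).trans hsupp), hsupp.trans hx⟩
  have hder : ∀ t v, fderiv ℝ ζ t v = - fderiv ℝ (mollifier n) (x - t) v := by
    intro t v
    have h1 : HasFDerivAt (mollifier n) (fderiv ℝ (mollifier n) (x - t)) (x - t) :=
      ((contDiff_mollifier n).differentiable (by norm_num)).differentiableAt.hasFDerivAt
    have h2 := h1.comp t ((hasFDerivAt_id t).const_sub x)
    have h3 : fderiv ℝ ζ t = _ := h2.fderiv
    rw [h3]; simp
  have hint : ∀ v, Integrable fun t => fderiv ℝ (mollifier n) (x - t) v • V t := by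
    intro v
    have h := (hζ.continuous_fderiv v).integrable_of_hasCompactSupport
      (hζ.hasCompactSupport_fderiv v) (μ := volume)
    have h' := (h.smul_bdd C hV.aestronglyMeasurable (ae_of_all _ hb)).neg
    refine h'.congr (ae_of_all _ fun t => ?_)
    simp [hder]
  have key := hdiv ζ hζ
  rw [fderiv_mollify' hV hb, fderiv_mollify' hV hb, ← Complex.reCLM_apply, ← Complex.imCLM_apply,
    ← ContinuousLinearMap.integral_comp_comm _ (hint e₁),
    ← ContinuousLinearMap.integral_comp_comm _ (hint e₂), ← integral_add
      (Complex.reCLM.integrable_comp (hint e₁)) (Complex.imCLM.integrable_comp (hint e₂)),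
    ← neg_eq_zero, ← integral_neg, ← key]
  congr 1
  funext t
  simp [hder]
  ring

/-- Translation invariance: the difference `V (· + h) - V` is divergence free wherever both `V` and
its translate are. -/
theorem DivFree.shift_sub {U U' : Set Plane} {V : Plane → ℂ} {C : ℝ} (hV : Measurable V)
    (hb : ∀ x, ‖V x‖ ≤ C) (hdiv : DivFree U V) {h : Plane} (hU : U' ⊆ U)
    (hUh : ∀ x ∈ U', x + h ∈ U) : DivFree U' fun x => V (x + h) - V x := by
  intro ζ hζ
  have hζ0 : IsTest U ζ := ⟨hζ.1, hζ.2, hζ.3.trans hU⟩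
  have hζ1 : IsTest U fun x => ζ (x - h) := by
    have hts : tsupport (fun x => ζ (x - h)) = (fun x => x - h) ⁻¹' tsupport ζ :=
      tsupport_comp_eq_preimage ζ (Homeomorph.subRight h)
    refine ⟨hζ.1.comp (contDiff_id.sub contDiff_const),
      hζ.2.comp_homeomorph (Homeomorph.subRight h), fun x hx => ?_⟩
    rw [hts] at hx
    simpa using hUh _ (hζ.3 hx)
  have e1 := hdiv _ hζ1
  have hder : ∀ x v, fderiv ℝ (fun x => ζ (x - h)) x v = fderiv ℝ ζ (x - h) v := by
    intro x v; rw [fderiv_comp_sub]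
  simp only [hder] at e1
  rw [← integral_add_right_eq_self _ h] at e1
  simp only [add_sub_cancel_right] at e1
  have hshift : Measurable fun x => V (x + h) := hV.comp (measurable_id.add_const h)
  have := integral_sub (integrable_divFree_integrand hshift (fun x => hb (x + h)) hζ)
    (integrable_divFree_integrand hV hb hζ)
  rw [e1, hdiv ζ hζ0, sub_zero] at this
  rw [← this]
  congr 1
  funext x
  simp
  ring

/-! ### Compensated compactness for finite differences of divergence-free fields -/

/-- The determinant of the real `2 × 2` matrix with rows `a` and `b`. -/
def cross (a b : ℂ) : ℝ := a.re * b.im - a.im * b.re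

theorem abs_cross_le (a b : ℂ) : |cross a b| ≤ 2 * ‖a‖ * ‖b‖ := by
  unfold cross
  have h1 := abs_sub (a.re * b.im) (a.im * b.re)
  rw [abs_mul, abs_mul] at h1
  have h2 := mul_le_mul (Complex.abs_re_le_norm a) (Complex.abs_im_le_norm b) (abs_nonneg _)
    (norm_nonneg _)
  have h3 := mul_le_mul (Complex.abs_im_le_norm a) (Complex.abs_re_le_norm b) (abs_nonneg _)
    (norm_nonneg _)
  linarith

theorem continuous_cross : Continuous fun p : ℂ × ℂ => cross p.1 p.2 := by
  unfold cross; fun_prop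

theorem measurable_cross {f g : Plane → ℂ} (hf : Measurable f) (hg : Measurable g) :
    Measurable fun x => cross (f x) (g x) :=
  continuous_cross.measurable.comp (hf.prodMk hg)

/-- If `div v = 0`, then `(h · ∇) v` is the rotated gradient of `h₂ v₁ - h₁ v₂`; hence its
determinant against a divergence-free `Y` is a divergence, and can be integrated by parts. -/
theorem integral_mul_cross_fderiv {U : Set Plane} {Y v : Plane → ℂ} {C D : ℝ} (hY : Measurable Y)
    (hYb : ∀ x, ‖Y x‖ ≤ D) (hYd : DivFree U Y) (hv : ContDiff ℝ ∞ v) (hvb : ∀ x, ‖v x‖ ≤ C)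
    {ζ : Plane → ℝ} (hζ : IsTest U ζ) (h : Plane)
    (hdiv : ∀ x ∈ U, (fderiv ℝ v x e₁).re + (fderiv ℝ v x e₂).im = 0) :
    |∫ x, ζ x * cross (fderiv ℝ v x h) (Y x)| ≤
      4 * C * ‖h‖ * ∫ x, ‖fderiv ℝ ζ x‖ * ‖Y x‖ := by
  set g : Plane → ℝ := fun x => h 1 * (v x).re - h 0 * (v x).im with hg
  have hvd : ∀ x, HasFDerivAt v (fderiv ℝ v x) x := fun x =>
    (hv.differentiable (by norm_num)).differentiableAt.hasFDerivAt
  have hgs : ContDiff ℝ ∞ g :=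
    (contDiff_const.mul (Complex.reCLM.contDiff.comp hv)).sub
      (contDiff_const.mul (Complex.imCLM.contDiff.comp hv))
  have hgd : ∀ x w, fderiv ℝ g x w
      = h 1 * (fderiv ℝ v x w).re - h 0 * (fderiv ℝ v x w).im := by
    intro x w
    have h1 := (Complex.reCLM.hasFDerivAt.comp x (hvd x)).const_mul (h 1)
    have h2 := (Complex.imCLM.hasFDerivAt.comp x (hvd x)).const_mul (h 0)
    have h3 : fderiv ℝ g x = _ := (h1.sub h2).fderiv
    rw [h3]; simp
  have hgb : ∀ x, |g x| ≤ 2 * ‖h‖ * C := by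
    intro x
    have h1 := abs_sub (h 1 * (v x).re) (h 0 * (v x).im)
    rw [abs_mul, abs_mul] at h1
    have h2 := mul_le_mul (abs_coord_le h 1) ((Complex.abs_re_le_norm (v x)).trans (hvb x))
      (abs_nonneg _) (norm_nonneg _)
    have h3 := mul_le_mul (abs_coord_le h 0) ((Complex.abs_im_le_norm (v x)).trans (hvb x))
      (abs_nonneg _) (norm_nonneg _)
    change |h 1 * (v x).re - h 0 * (v x).im| ≤ _
    linarith
  have key := hYd _ (hζ.mul hgs)
  have hprod : ∀ x w, fderiv ℝ (fun x => ζ x * g x) x w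
      = ζ x * fderiv ℝ g x w + g x * fderiv ℝ ζ x w := by
    intro x w
    rw [fderiv_fun_mul hζ.differentiable.differentiableAt
      (hgs.differentiable (by norm_num)).differentiableAt]
    simp
  have hpt : ∀ x, (Y x).re * fderiv ℝ (fun x => ζ x * g x) x e₁
      + (Y x).im * fderiv ℝ (fun x => ζ x * g x) x e₂
      = ζ x * cross (fderiv ℝ v x h) (Y x)
        + g x * ((Y x).re * fderiv ℝ ζ x e₁ + (Y x).im * fderiv ℝ ζ x e₂) := by
    intro x
    rw [hprod, hprod]
    by_cases hx : x ∈ U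
    · have hlin : fderiv ℝ v x h = h 0 • fderiv ℝ v x e₁ + h 1 • fderiv ℝ v x e₂ := by
        conv_lhs => rw [plane_eq h]
        simp
      have hd := hdiv x hx
      rw [hgd, hgd, hlin]
      simp only [cross, Complex.add_re, Complex.add_im, Complex.real_smul, Complex.re_ofReal_mul,
        Complex.im_ofReal_mul]
      linear_combination (- ζ x * h 0 * (Y x).im + ζ x * h 1 * (Y x).re) * hd
    · have : ζ x = 0 := image_eq_zero_of_notMem_tsupport fun hx' => hx (hζ.3 hx')
      rw [this]; ring
  simp only [hpt] at key
  have hint2 : Integrable fun x =>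
      g x * ((Y x).re * fderiv ℝ ζ x e₁ + (Y x).im * fderiv ℝ ζ x e₂) :=
    (integrable_divFree_integrand hY hYb hζ).bdd_mul (c := 2 * ‖h‖ * C)
      hgs.continuous.aestronglyMeasurable (ae_of_all _ hgb)
  have hint1 : Integrable fun x => ζ x * cross (fderiv ℝ v x h) (Y x) := by
    have h0 := (integrable_divFree_integrand hY hYb (hζ.mul hgs)).sub hint2
    refine h0.congr (ae_of_all _ fun x => ?_)
    simp only [Pi.sub_apply]
    rw [hpt x]; ring
  rw [integral_add hint1 hint2, add_eq_zero_iff_eq_neg] at key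
  rw [key, abs_neg, ← integral_const_mul, ← Real.norm_eq_abs]
  refine norm_integral_le_of_norm_le ?_ (ae_of_all _ fun x => ?_)
  · refine Integrable.const_mul ?_ _
    have hc : Continuous (fderiv ℝ ζ) := hζ.contDiff.continuous_fderiv (by norm_num)
    have hs : HasCompactSupport (fderiv ℝ ζ) := hζ.hasCompactSupport.fderiv ℝ
    exact integrable_mul_of_bounded (𝕜 := ℝ) (C := D) hc.norm hs.norm
      hY.norm.aestronglyMeasurable (fun x => by simpa using hYb x)
  · have hf1 : |fderiv ℝ ζ x e₁| ≤ ‖fderiv ℝ ζ x‖ := by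
      simpa [norm_e₁] using (fderiv ℝ ζ x).le_opNorm e₁
    have hf2 : |fderiv ℝ ζ x e₂| ≤ ‖fderiv ℝ ζ x‖ := by
      simpa [norm_e₂] using (fderiv ℝ ζ x).le_opNorm e₂
    rw [Real.norm_eq_abs, abs_mul]
    have h1 := abs_add_le ((Y x).re * fderiv ℝ ζ x e₁) ((Y x).im * fderiv ℝ ζ x e₂)
    rw [abs_mul, abs_mul] at h1
    have h2 := mul_le_mul (Complex.abs_re_le_norm (Y x)) hf1 (abs_nonneg _) (norm_nonneg _)
    have h3 := mul_le_mul (Complex.abs_im_le_norm (Y x)) hf2 (abs_nonneg _) (norm_nonneg _)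
    calc |g x| * _ ≤ (2 * ‖h‖ * C) * (2 * (‖fderiv ℝ ζ x‖ * ‖Y x‖)) :=
          mul_le_mul (hgb x) (by linarith) (abs_nonneg _) ((abs_nonneg _).trans (hgb x))
      _ = _ := by ring

theorem fderiv_mollify_bounded {g : Plane → ℂ} {C : ℝ} (hg : Measurable g) (hb : ∀ x, ‖g x‖ ≤ C)
    (n : ℕ) : ∃ L : ℝ, ∀ x v, ‖fderiv ℝ (mollify n g) x v‖ ≤ L * ‖v‖ := by
  have hcont : Continuous (fderiv ℝ (mollifier n)) :=
    (contDiff_mollifier n).continuous_fderiv (by norm_num)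
  have hint : Integrable fun t => ‖fderiv ℝ (mollifier n) t‖ :=
    hcont.norm.integrable_of_hasCompactSupport ((hasCompactSupport_mollifier n).fderiv ℝ).norm
  refine ⟨(∫ t, ‖fderiv ℝ (mollifier n) t‖) * C, fun x v => ?_⟩
  rw [fderiv_mollify hg hb, mul_assoc, ← integral_mul_const]
  refine norm_integral_le_of_norm_le (hint.mul_const _) (ae_of_all _ fun t => ?_)
  rw [norm_smul]
  calc ‖fderiv ℝ (mollifier n) t v‖ * ‖g (x - t)‖
      ≤ (‖fderiv ℝ (mollifier n) t‖ * ‖v‖) * C :=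
        mul_le_mul (ContinuousLinearMap.le_opNorm _ _) (hb _) (norm_nonneg _) (by positivity)
    _ = _ := by ring

/-- Integrating the previous estimate along the segment from `x` to `x + h`. -/
theorem integral_mul_cross_sub {U : Set Plane} {Y v : Plane → ℂ} {C D L : ℝ} (hY : Measurable Y)
    (hYb : ∀ x, ‖Y x‖ ≤ D) (hYd : DivFree U Y) (hv : ContDiff ℝ ∞ v) (hvb : ∀ x, ‖v x‖ ≤ C)
    (hL : ∀ x w, ‖fderiv ℝ v x w‖ ≤ L * ‖w‖) {ζ : Plane → ℝ} (hζ : IsTest U ζ) (h : Plane)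
    (hdiv : ∀ x ∈ U, ∀ t ∈ Icc (0 : ℝ) 1,
      (fderiv ℝ v (x + t • h) e₁).re + (fderiv ℝ v (x + t • h) e₂).im = 0) :
    |∫ x, ζ x * cross (v (x + h) - v x) (Y x)| ≤
      4 * C * ‖h‖ * ∫ x, ‖fderiv ℝ ζ x‖ * ‖Y x‖ := by
  have hmeas : ∀ t : ℝ, Measurable fun x => v (x + t • h) := fun t =>
    hv.continuous.measurable.comp (measurable_id.add_const _)
  have hint : ∀ t : ℝ, Integrable fun x => ζ x * cross (v (x + t • h)) (Y x) := fun t =>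
    integrable_mul_of_bounded (𝕜 := ℝ) (C := 2 * C * D) hζ.1.continuous hζ.2
      (measurable_cross (hmeas t) hY).aestronglyMeasurable fun x => by
        refine (abs_cross_le _ _).trans ?_
        have := mul_le_mul (hvb (x + t • h)) (hYb x) (norm_nonneg _)
          ((norm_nonneg _).trans (hvb x))
        linarith
  have hderiv : ∀ t : ℝ, HasDerivAt (fun t : ℝ => ∫ x, ζ x * cross (v (x + t • h)) (Y x))
      (∫ x, ζ x * cross (fderiv ℝ v (x + t • h) h) (Y x)) t := by
    intro t
    have hDcont : Continuous fun x => fderiv ℝ v (x + t • h) h :=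
      ((hv.continuous_fderiv (by norm_num)).comp (continuous_id.add continuous_const)).clm_apply
        continuous_const
    refine (hasDerivAt_integral_of_dominated_loc_of_deriv_le (s := univ)
      (F' := fun t x => ζ x * cross (fderiv ℝ v (x + t • h) h) (Y x))
      (bound := fun x => |ζ x| * (2 * (L * ‖h‖) * D)) univ_mem
      (Eventually.of_forall fun t => (hint t).aestronglyMeasurable) (hint t) ?_ ?_ ?_ ?_).2
    · exact (hζ.1.continuous.measurable.mul
        (measurable_cross hDcont.measurable hY)).aestronglyMeasurable
    · refine ae_of_all _ fun x s _ => ?_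
      rw [norm_mul, Real.norm_eq_abs, Real.norm_eq_abs]
      refine mul_le_mul_of_nonneg_left ((abs_cross_le _ _).trans ?_) (abs_nonneg _)
      have := mul_le_mul (hL (x + s • h) h) (hYb x) (norm_nonneg _)
        ((norm_nonneg _).trans (hL (x + s • h) h))
      linarith
    · exact ((hζ.1.continuous.integrable_of_hasCompactSupport hζ.2).abs).mul_const _
    · refine ae_of_all _ fun x s _ => ?_
      have h1 : HasDerivAt (fun s : ℝ => x + s • h) h s := by
        simpa using ((hasDerivAt_id s).smul_const h).const_add x
      have h2 : HasFDerivAt v (fderiv ℝ v (x + s • h)) (x + s • h) :=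
        (hv.differentiable (by norm_num)).differentiableAt.hasFDerivAt
      have h3 := h2.comp_hasDerivAt s h1
      have hre := (Complex.reCLM.hasFDerivAt (x := v (x + s • h))).comp_hasDerivAt s h3
      have him := (Complex.imCLM.hasFDerivAt (x := v (x + s • h))).comp_hasDerivAt s h3
      exact ((hre.mul_const (Y x).im).sub (him.mul_const (Y x).re)).const_mul (ζ x)
  have hbound : ∀ t ∈ Icc (0 : ℝ) 1,
      ‖∫ x, ζ x * cross (fderiv ℝ v (x + t • h) h) (Y x)‖
        ≤ 4 * C * ‖h‖ * ∫ x, ‖fderiv ℝ ζ x‖ * ‖Y x‖ := by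
    intro t ht
    have hd : ∀ x, fderiv ℝ (fun x => v (x + t • h)) x = fderiv ℝ v (x + t • h) := fun x => by
      rw [fderiv_comp_add_right]
    have := integral_mul_cross_fderiv hY hYb hYd (v := fun x => v (x + t • h))
      (hv.comp (contDiff_id.add contDiff_const)) (fun x => hvb _) hζ h
      (fun x hx => by rw [hd]; exact hdiv x hx t ht)
    simpa only [hd, Real.norm_eq_abs] using this
  have hmv := Convex.norm_image_sub_le_of_norm_hasDerivWithin_le
    (fun t _ => (hderiv t).hasDerivWithinAt) hbound (convex_Icc (0 : ℝ) 1)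
    (left_mem_Icc.2 zero_le_one) (right_mem_Icc.2 zero_le_one)
  rw [← integral_sub (hint 1) (hint 0)] at hmv
  simp only [one_smul, zero_smul, add_zero, sub_zero, norm_one, mul_one] at hmv
  convert hmv using 1
  rw [Real.norm_eq_abs]
  congr 2
  funext x
  simp [cross]
  ring

/-- A quantitative div-curl estimate: the determinant of the finite differences of two bounded
divergence-free fields is of order `‖h‖` times the difference of one of them. -/
theorem integral_mul_cross_shift_le {U U' : Set Plane} {V W : Plane → ℂ} {C D r : ℝ}
    (hV : Measurable V) (hVb : ∀ x, ‖V x‖ ≤ C) (hVd : DivFree U V)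
    (hW : Measurable W) (hWb : ∀ x, ‖W x‖ ≤ D) (hWd : DivFree U W)
    (hU : ∀ x ∈ U', ∀ y, ‖y‖ ≤ r → x + y ∈ U)
    {ζ : Plane → ℝ} (hζ : IsTest U' ζ) {h : Plane} (hh : ‖h‖ < r) :
    |∫ x, ζ x * cross (V (x + h) - V x) (W (x + h) - W x)| ≤
      4 * C * ‖h‖ * ∫ x, ‖fderiv ℝ ζ x‖ * ‖W (x + h) - W x‖ := by
  have hr : 0 < r := (norm_nonneg h).trans_lt hh
  have hWs : Measurable fun x => W (x + h) - W x :=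
    (hW.comp (measurable_id.add_const h)).sub hW
  have hWsb : ∀ x, ‖W (x + h) - W x‖ ≤ 2 * D := fun x => by
    have := norm_sub_le (W (x + h)) (W x)
    linarith [hWb (x + h), hWb x]
  have hWsd : DivFree U' fun x => W (x + h) - W x :=
    hWd.shift_sub hW hWb (fun x hx => by simpa using hU x hx 0 (by simpa using hr.le))
      (fun x hx => hU x hx h hh.le)
  have hsmall : ∀ᶠ n in atTop, 2 * scale n ^ 3 < r - ‖h‖ := by
    have : Tendsto (fun n => 2 * scale n ^ 3) atTop (𝓝 0) := by
      simpa using (tendsto_scale.pow 3).const_mul 2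
    exact this.eventually_lt_const (sub_pos.2 hh)
  have hest : ∀ᶠ n in atTop,
      |∫ x, ζ x * cross (mollify n V (x + h) - mollify n V x) (W (x + h) - W x)| ≤
        4 * C * ‖h‖ * ∫ x, ‖fderiv ℝ ζ x‖ * ‖W (x + h) - W x‖ := by
    filter_upwards [hsmall] with n hn
    obtain ⟨L, hL⟩ := fderiv_mollify_bounded hV hVb n
    refine integral_mul_cross_sub hWs hWsb hWsd (contDiff_mollify hV hVb n)
      (norm_mollify_le hVb n) hL hζ h fun x hx t ht => ?_
    refine div_mollify_eq_zero hV hVb hVd fun y hy => ?_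
    have : y = x + (t • h + (y - (x + t • h))) := by abel
    rw [this]
    refine hU x hx _ ((norm_add_le _ _).trans ?_)
    rw [norm_smul, Real.norm_of_nonneg ht.1]
    rw [Metric.mem_closedBall, dist_eq_norm] at hy
    have := mul_le_of_le_one_left (norm_nonneg h) ht.2
    linarith
  have hlim : Tendsto (fun n => ∫ x, ζ x *
      cross (mollify n V (x + h) - mollify n V x) (W (x + h) - W x)) atTop
      (𝓝 (∫ x, ζ x * cross (V (x + h) - V x) (W (x + h) - W x))) := by
    have hae := ae_tendsto_mollify hV hVb
    have haeh : ∀ᵐ x, Tendsto (fun n => mollify n V (x + h)) atTop (𝓝 (V (x + h))) :=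
      (measurePreserving_add_right volume h).quasiMeasurePreserving.ae hae
    refine tendsto_integral_of_dominated_convergence (fun x => |ζ x| * (2 * (2 * C) * (2 * D)))
      (fun n => ?_) ?_ (fun n => ae_of_all _ fun x => ?_) ?_
    · have hm := (contDiff_mollify hV hVb n).continuous.measurable
      exact (hζ.1.continuous.measurable.mul (measurable_cross
        ((hm.comp (measurable_id.add_const h)).sub hm) hWs)).aestronglyMeasurable
    · exact ((hζ.1.continuous.integrable_of_hasCompactSupport hζ.2).abs).mul_const _
    · rw [norm_mul, Real.norm_eq_abs, Real.norm_eq_abs]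
      refine mul_le_mul_of_nonneg_left ((abs_cross_le _ _).trans ?_) (abs_nonneg _)
      have h1 : ‖mollify n V (x + h) - mollify n V x‖ ≤ 2 * C := by
        have := norm_sub_le (mollify n V (x + h)) (mollify n V x)
        linarith [norm_mollify_le hVb n (x + h), norm_mollify_le hVb n x]
      have := mul_le_mul h1 (hWsb x) (norm_nonneg _) ((norm_nonneg _).trans h1)
      linarith
    · filter_upwards [hae, haeh] with x hx hxh
      exact ((continuous_cross.tendsto _).comp ((hxh.sub hx).prodMk_nhds
        tendsto_const_nhds)).const_mul _
  exact le_of_tendsto hlim.abs hest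

/-! ### Fractional regularity from coercivity of the determinant -/

/-- The complex form of the hypotheses on the gradient `m` of an element of `E`, with `m` taken of
unit length everywhere. The field `I * m` is divergence free because `m` is a gradient; the other
two fields are six times `Σ_{e₁e₂}` and `Σ_{ε₁ε₂}` on the unit circle. -/
structure IsEikonal (U : Set Plane) (m : Plane → ℂ) : Prop where
  measurable : Measurable m
  norm_eq_one : ∀ x, ‖m x‖ = 1
  curl : DivFree U fun x => Complex.I * m x
  sigma : DivFree U fun x => 3 * conj (m x) + m x ^ 3
  sigma' : DivFree U fun x => Complex.I * (3 * conj (m x) - m x ^ 3)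

theorem cross_conj_add (a b : ℂ) :
    cross (3 * conj a + b) (Complex.I * (3 * conj a - b)) = 9 * ‖a‖ ^ 2 - ‖b‖ ^ 2 := by
  rw [Complex.sq_norm, Complex.sq_norm, Complex.normSq_apply, Complex.normSq_apply]
  simp [cross]
  ring

theorem norm_sq_add_mul_add_sq {p q : ℂ} (hp : ‖p‖ = 1) (hq : ‖q‖ = 1) :
    ‖p ^ 2 + p * q + q ^ 2‖ ^ 2 = (3 - ‖p - q‖ ^ 2) ^ 2 := by
  have hp' : p * conj p = 1 := by rw [Complex.mul_conj']; simp [hp]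
  have hq' : q * conj q = 1 := by rw [Complex.mul_conj']; simp [hq]
  have h1 : p ^ 2 + p * q + q ^ 2 = p * q * (p * conj q + 1 + q * conj p) := by
    linear_combination (-p ^ 2) * hq' - q ^ 2 * hp'
  have h2 : p * conj q + 1 + q * conj p = ((3 - ‖p - q‖ ^ 2 : ℝ) : ℂ) := by
    push_cast
    rw [← Complex.mul_conj' (p - q)]
    simp only [map_sub]
    linear_combination hp' + hq'
  rw [h1, h2, norm_mul, norm_mul, hp, hq, Complex.norm_real, Real.norm_eq_abs, one_mul, one_mul,
    sq_abs]

theorem norm_sub_sq_le_four {p q : ℂ} (hp : ‖p‖ = 1) (hq : ‖q‖ = 1) : ‖p - q‖ ^ 2 ≤ 4 := by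
  have := norm_sub_le p q
  nlinarith [norm_nonneg (p - q)]

theorem norm_cube_sub_cube {p q : ℂ} (hp : ‖p‖ = 1) (hq : ‖q‖ = 1) :
    ‖p ^ 3 - q ^ 3‖ ^ 2 = ‖p - q‖ ^ 2 * (3 - ‖p - q‖ ^ 2) ^ 2 := by
  rw [← norm_sq_add_mul_add_sq hp hq, ← mul_pow, ← norm_mul]
  congr 2
  ring

/-- The set of values of the two entropy fields has no rank-one connections: the determinant
of a difference is bounded below by the fourth power of its length. -/
theorem two_mul_norm_pow_four_le_cross {p q : ℂ} (hp : ‖p‖ = 1) (hq : ‖q‖ = 1) :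
    2 * ‖p - q‖ ^ 4 ≤ cross ((3 * conj p + p ^ 3) - (3 * conj q + q ^ 3))
      (Complex.I * (3 * conj p - p ^ 3) - Complex.I * (3 * conj q - q ^ 3)) := by
  have h1 : (3 * conj p + p ^ 3) - (3 * conj q + q ^ 3)
      = 3 * conj (p - q) + (p ^ 3 - q ^ 3) := by rw [map_sub]; ring
  have h2 : Complex.I * (3 * conj p - p ^ 3) - Complex.I * (3 * conj q - q ^ 3)
      = Complex.I * (3 * conj (p - q) - (p ^ 3 - q ^ 3)) := by rw [map_sub]; ring
  rw [h1, h2, cross_conj_add, norm_cube_sub_cube hp hq]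
  have h4 := norm_sub_sq_le_four hp hq
  have : 0 ≤ (‖p - q‖ ^ 2) ^ 2 * (4 - ‖p - q‖ ^ 2) :=
    mul_nonneg (sq_nonneg _) (by linarith)
  nlinarith [this]

theorem norm_sigma'_sub_le {p q : ℂ} (hp : ‖p‖ = 1) (hq : ‖q‖ = 1) :
    ‖Complex.I * (3 * conj p - p ^ 3) - Complex.I * (3 * conj q - q ^ 3)‖ ≤ 6 * ‖p - q‖ := by
  have h2 : Complex.I * (3 * conj p - p ^ 3) - Complex.I * (3 * conj q - q ^ 3)
      = Complex.I * (3 * conj (p - q) - (p - q) * (p ^ 2 + p * q + q ^ 2)) := by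
    rw [map_sub]; ring
  have h3 : ‖p ^ 2 + p * q + q ^ 2‖ ≤ 3 := by
    calc ‖p ^ 2 + p * q + q ^ 2‖ ≤ ‖p ^ 2‖ + ‖p * q‖ + ‖q ^ 2‖ := norm_add₃_le
      _ = 3 := by simp [hp, hq]; norm_num
  rw [h2, norm_mul, Complex.norm_I, one_mul]
  refine (norm_sub_le _ _).trans ?_
  rw [norm_mul, norm_mul, RCLike.norm_conj]
  have := mul_le_mul_of_nonneg_left h3 (norm_nonneg (p - q))
  norm_num
  linarith

theorem pow_three_mul_le {x y : ℝ} (hx : 0 ≤ x) (hy : 0 ≤ y) : x ^ 3 * y ≤ x ^ 4 + y ^ 4 := by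
  rcases le_total x y with h | h
  · have := mul_le_mul_of_nonneg_right (pow_le_pow_left₀ hx h 3) hy
    nlinarith [pow_nonneg hx 4]
  · have := mul_le_mul_of_nonneg_left h (pow_nonneg hx 3)
    nlinarith [pow_nonneg hy 4]

theorem IsEikonal.norm_sigma_le {U : Set Plane} {m : Plane → ℂ} (hm : IsEikonal U m) (x : Plane) :
    ‖3 * conj (m x) + m x ^ 3‖ ≤ 4 := by
  refine (norm_add_le _ _).trans ?_
  rw [norm_mul, norm_pow, RCLike.norm_conj, hm.norm_eq_one]
  norm_num

theorem IsEikonal.norm_sigma'_le {U : Set Plane} {m : Plane → ℂ} (hm : IsEikonal U m) (x : Plane) :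
    ‖Complex.I * (3 * conj (m x) - m x ^ 3)‖ ≤ 4 := by
  rw [norm_mul, Complex.norm_I, one_mul]
  refine (norm_sub_le _ _).trans ?_
  rw [norm_mul, norm_pow, RCLike.norm_conj, hm.norm_eq_one]
  norm_num

/-- The field `m` has local Besov regularity `B^{1/3}_{4,∞}`; here `‖h‖ = k ^ 3`. -/
theorem IsEikonal.exists_shift_bound {U U' : Set Plane} {m : Plane → ℂ} {r : ℝ}
    (hm : IsEikonal U m) (hU : ∀ x ∈ U', ∀ y, ‖y‖ ≤ r → x + y ∈ U)
    {η : Plane → ℝ} (hη : IsTest U' η) (hη0 : ∀ x, 0 ≤ η x) (hη1 : ∀ x, η x ≤ 1) :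
    ∃ C : ℝ, 0 ≤ C ∧ ∀ (h : Plane) (k : ℝ), 0 ≤ k → ‖h‖ = k ^ 3 → ‖h‖ < r →
      ∫ x, η x ^ 4 * ‖m (x + h) - m x‖ ^ 4 ≤ C * k ^ 4 := by
  have hDc : Continuous (fderiv ℝ η) := hη.contDiff.continuous_fderiv (by norm_num)
  have hDs : HasCompactSupport (fderiv ℝ η) := hη.hasCompactSupport.fderiv ℝ
  obtain ⟨L, hL⟩ := hDc.bounded_above_of_compact_support hDs
  have hL0 : 0 ≤ L := (norm_nonneg _).trans (hL 0)
  set S := tsupport η with hS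
  have hSc : IsCompact S := hη.hasCompactSupport
  have hSm : MeasurableSet S := hSc.isClosed.measurableSet
  set B : ℝ := max 1 (384 * L) with hB
  have hB1 : 1 ≤ B := le_max_left _ _
  have hBL : 384 * L ≤ B ^ 3 := (le_max_right _ _).trans (le_self_pow₀ hB1 (by norm_num))
  refine ⟨B ^ 4 * volume.real S, by positivity, fun h k hk hhk hhr => ?_⟩
  set d : Plane → ℝ := fun x => ‖m (x + h) - m x‖ with hd
  have hdm : Measurable d := ((hm.measurable.comp (measurable_id.add_const h)).sub
    hm.measurable).norm
  have hd0 : ∀ x, 0 ≤ d x := fun x => norm_nonneg _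
  have hd2 : ∀ x, d x ≤ 2 := fun x => by
    have := norm_sub_le (m (x + h)) (m x)
    rw [hm.norm_eq_one, hm.norm_eq_one] at this
    linarith
  -- With the fourth power of the cutoff, `|Dζ|` is at most a multiple of `η`. The right-hand side
  -- of the compensated compactness estimate is then `|h| η |m(· + h) - m|`, which Young's
  -- inequality splits into the left-hand side and a multiple of `|h|^{4/3} = k⁴`.
  set ζ : Plane → ℝ := fun x => η x ^ 4 with hζdef
  have hζ : IsTest U' ζ := by
    have h4 : ζ = fun x => η x * (η x ^ 3) := by funext x; simp only [hζdef]; ring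
    rw [h4]
    exact hη.mul (hη.contDiff.pow 3)
  have hζD : ∀ x, ‖fderiv ℝ ζ x‖ ≤ 4 * L * η x := by
    intro x
    have h1 : fderiv ℝ ζ x = (4 * η x ^ 3) • fderiv ℝ η x := by
      have := (hη.differentiable x).hasFDerivAt.pow 4
      simpa using this.fderiv
    have h3 : η x ^ 3 ≤ η x := pow_le_of_le_one (hη0 x) (hη1 x) (by norm_num)
    rw [h1, norm_smul, Real.norm_of_nonneg (by have := hη0 x; positivity)]
    calc 4 * η x ^ 3 * ‖fderiv ℝ η x‖ ≤ 4 * η x * L :=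
          mul_le_mul (by linarith) (hL x) (norm_nonneg _) (by linarith [hη0 x])
      _ = _ := by ring
  have hVm : Measurable fun x => 3 * conj (m x) + m x ^ 3 := by
    have hc : Continuous fun z : ℂ => 3 * conj z + z ^ 3 := by fun_prop
    exact hc.measurable.comp hm.measurable
  have hWm : Measurable fun x => Complex.I * (3 * conj (m x) - m x ^ 3) := by
    have hc : Continuous fun z : ℂ => Complex.I * (3 * conj z - z ^ 3) := by fun_prop
    exact hc.measurable.comp hm.measurable
  have key := integral_mul_cross_shift_le hVm hm.norm_sigma_le hm.sigma hWm hm.norm_sigma'_le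
    hm.sigma' hU hζ hhr
  have hX : Integrable fun x => ζ x * d x ^ 4 :=
    integrable_mul_of_bounded (𝕜 := ℝ) (C := 2 ^ 4) hζ.1.continuous hζ.2
      (hdm.pow_const 4).aestronglyMeasurable fun x => by
        rw [Real.norm_of_nonneg (pow_nonneg (hd0 x) 4)]
        exact pow_le_pow_left₀ (hd0 x) (hd2 x) 4
  have hlow : ∫ x, 2 * (ζ x * d x ^ 4) ≤ ∫ x, ζ x * cross
      ((3 * conj (m (x + h)) + m (x + h) ^ 3) - (3 * conj (m x) + m x ^ 3))
      (Complex.I * (3 * conj (m (x + h)) - m (x + h) ^ 3)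
        - Complex.I * (3 * conj (m x) - m x ^ 3)) := by
    refine integral_mono (hX.const_mul 2) ?_ fun x => ?_
    · refine integrable_mul_of_bounded (𝕜 := ℝ) (C := 2 * 8 * 8) hζ.1.continuous hζ.2
        (measurable_cross ((hVm.comp (measurable_id.add_const h)).sub hVm)
          ((hWm.comp (measurable_id.add_const h)).sub hWm)).aestronglyMeasurable fun x => ?_
      refine (abs_cross_le _ _).trans ?_
      have h1 := norm_sub_le_of_le (hm.norm_sigma_le (x + h)) (hm.norm_sigma_le x)
      have h2 := norm_sub_le_of_le (hm.norm_sigma'_le (x + h)) (hm.norm_sigma'_le x)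
      have := mul_le_mul h1 h2 (norm_nonneg _) (by norm_num)
      linarith
    · have h1 := two_mul_norm_pow_four_le_cross (hm.norm_eq_one (x + h)) (hm.norm_eq_one x)
      have h2 : 0 ≤ ζ x := pow_nonneg (hη0 x) 4
      calc 2 * (ζ x * d x ^ 4) = ζ x * (2 * d x ^ 4) := by ring
        _ ≤ _ := mul_le_mul_of_nonneg_left h1 h2
  have hind : Integrable (S.indicator fun _ => B ^ 4 * k ^ 4) :=
    (integrable_indicator_iff hSm).2 (integrableOn_const hSc.measure_lt_top.ne)
  have hup : 4 * 4 * ‖h‖ * ∫ x, ‖fderiv ℝ ζ x‖ *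
      ‖Complex.I * (3 * conj (m (x + h)) - m (x + h) ^ 3)
        - Complex.I * (3 * conj (m x) - m x ^ 3)‖
      ≤ ∫ x, (ζ x * d x ^ 4 + S.indicator (fun _ => B ^ 4 * k ^ 4) x) := by
    rw [← integral_const_mul]
    refine integral_mono_of_nonneg (ae_of_all _ fun x => by positivity) (hX.add hind)
      (ae_of_all _ fun x => ?_)
    have hW := norm_sigma'_sub_le (hm.norm_eq_one (x + h)) (hm.norm_eq_one x)
    have hη0' := hη0 x
    have hd0' := hd0 x
    have h1 : 4 * 4 * ‖h‖ * (‖fderiv ℝ ζ x‖ *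
        ‖Complex.I * (3 * conj (m (x + h)) - m (x + h) ^ 3)
          - Complex.I * (3 * conj (m x) - m x ^ 3)‖) ≤ (B * k) ^ 3 * (η x * d x) := by
      calc _ ≤ 4 * 4 * k ^ 3 * ((4 * L * η x) * (6 * d x)) := by
            rw [hhk]
            exact mul_le_mul_of_nonneg_left (mul_le_mul (hζD x) hW (norm_nonneg _)
              (by positivity)) (by positivity)
        _ = (384 * L) * (k ^ 3 * (η x * d x)) := by ring
        _ ≤ B ^ 3 * (k ^ 3 * (η x * d x)) := mul_le_mul_of_nonneg_right hBL (by positivity)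
        _ = _ := by ring
    refine h1.trans ?_
    by_cases hx : x ∈ S
    · simp only [indicator_of_mem hx]
      have := pow_three_mul_le (x := B * k) (y := η x * d x) (by positivity) (by positivity)
      calc _ ≤ _ := this
        _ = _ := by simp only [hζdef]; ring
    · have hz : η x = 0 := image_eq_zero_of_notMem_tsupport hx
      simp [hz, hζdef, indicator_of_notMem hx]
  have hfin := (hlow.trans ((le_abs_self _).trans key)).trans hup
  rw [integral_const_mul, integral_add hX hind, integral_indicator hSm, setIntegral_const,
    smul_eq_mul] at hfin
  change ∫ x, ζ x * d x ^ 4 ≤ _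
  linarith

/-! ### Commutator estimates -/

theorem norm_sub_le_two {m : Plane → ℂ} (h1 : ∀ x, ‖m x‖ = 1) (x y : Plane) :
    ‖m x - m y‖ ≤ 2 := by
  have := norm_sub_le (m x) (m y)
  rw [h1, h1] at this
  linarith

theorem measurable_shift_norm {m : Plane → ℂ} (hm : Measurable m) (x : Plane) :
    Measurable fun t => ‖m (x - t) - m x‖ :=
  ((hm.comp (measurable_const.sub measurable_id)).sub_const _).norm

theorem integrableOn_shift_pow {m : Plane → ℂ} (hm : Measurable m) (h1 : ∀ x, ‖m x‖ = 1)
    (x : Plane) (j : ℕ) (R : ℝ) :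
    IntegrableOn (fun t => ‖m (x - t) - m x‖ ^ j) (Metric.closedBall 0 R) := by
  refine Measure.integrableOn_of_bounded (M := 2 ^ j) measure_closedBall_lt_top.ne
    ((measurable_shift_norm hm x).pow_const j).aestronglyMeasurable (ae_of_all _ fun t => ?_)
  rw [norm_pow, norm_norm]
  exact pow_le_pow_left₀ (norm_nonneg _) (norm_sub_le_two h1 _ _) j

/-- For unit vectors `1 - |M|²` is at most the variance of `m` under the mollifier, hence quadratic
in the differences of `m`. -/
theorem one_sub_norm_mollify_sq_le {m : Plane → ℂ} (hm : Measurable m) (h1 : ∀ x, ‖m x‖ = 1)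
    {C : ℝ} {n : ℕ} (hC : ∀ x, mollifier n x ≤ C / scale n ^ 6) (x : Plane) :
    1 - ‖mollify n m x‖ ^ 2 ≤ C / scale n ^ 6 *
      ∫ t in Metric.closedBall 0 (2 * scale n ^ 3), ‖m (x - t) - m x‖ ^ 2 := by
  have hb : ∀ x, ‖m x‖ ≤ 1 := fun x => (h1 x).le
  have hint := integrable_mollifier_smul hm hb n x
  have hsq : ∀ t, mollifier n t * ‖m (x - t) - m x‖ ^ 2
      = 2 * mollifier n t - 2 * ((mollifier n t • m (x - t)) * conj (m x)).re := by
    intro t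
    have h2 : ‖m (x - t) - m x‖ ^ 2 = 2 - 2 * (m (x - t) * conj (m x)).re := by
      rw [Complex.sq_norm, Complex.normSq_sub, ← Complex.sq_norm, ← Complex.sq_norm, h1, h1]
      norm_num
    rw [h2, smul_mul_assoc, Complex.smul_re]
    simp only [smul_eq_mul]
    ring
  have hI2 : Integrable fun t => ((mollifier n t • m (x - t)) * conj (m x)).re :=
    Complex.reCLM.integrable_comp (hint.mul_const _)
  have hval : ∫ t, mollifier n t * ‖m (x - t) - m x‖ ^ 2
      = 2 - 2 * (mollify n m x * conj (m x)).re := by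
    simp only [hsq]
    rw [integral_sub ((integrable_mollifier n).const_mul 2) (hI2.const_mul 2), integral_const_mul,
      integral_mollifier, integral_const_mul, mollify_apply, ← integral_mul_const]
    have := ContinuousLinearMap.integral_comp_comm Complex.reCLM (hint.mul_const (conj (m x)))
    simp only [Complex.reCLM_apply] at this
    rw [this]
    ring
  have hre : (mollify n m x * conj (m x)).re ≤ ‖mollify n m x‖ := by
    refine (Complex.re_le_norm _).trans ?_
    rw [norm_mul, RCLike.norm_conj, h1, mul_one]
  have hstep : 1 - ‖mollify n m x‖ ^ 2 ≤ ∫ t, mollifier n t * ‖m (x - t) - m x‖ ^ 2 := by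
    rw [hval]; nlinarith [sq_nonneg (1 - ‖mollify n m x‖)]
  refine hstep.trans ?_
  have hvan : ∀ t, t ∉ Metric.closedBall (0 : Plane) (2 * scale n ^ 3) →
      mollifier n t * ‖m (x - t) - m x‖ ^ 2 = 0 := by
    intro t ht
    rw [← tsupport_mollifier] at ht
    rw [image_eq_zero_of_notMem_tsupport ht, zero_mul]
  rw [← setIntegral_eq_integral_of_forall_compl_eq_zero hvan, ← integral_const_mul]
  refine integral_mono_of_nonneg (ae_of_all _ fun t => ?_)
    ((integrableOn_shift_pow hm h1 x 2 _).const_mul _) (ae_of_all _ fun t => ?_)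
  · exact mul_nonneg (mollifier_nonneg n t) (sq_nonneg _)
  · exact mul_le_mul_of_nonneg_right (hC t) (sq_nonneg _)

theorem integral_fderiv_mollifier_smul (n : ℕ) (v : Plane) (c : ℂ) :
    ∫ t, fderiv ℝ (mollifier n) t v • c = 0 := by
  have h0 : mollify n (fun _ => c) = fun _ => c := by
    funext x
    rw [mollify_apply, integral_smul_const, integral_mollifier, one_smul]
  rw [← fderiv_mollify (g := fun _ => c) measurable_const (fun _ => le_rfl) n 0 v, h0]
  simp

/-- The derivative of the mollifier has integral zero, so that `DM` is linear in the differences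
of `m`. -/
theorem norm_fderiv_mollify_le {m : Plane → ℂ} (hm : Measurable m) (h1 : ∀ x, ‖m x‖ = 1)
    {C : ℝ} {n : ℕ} (hC : ∀ x, ‖fderiv ℝ (mollifier n) x‖ ≤ C / scale n ^ 9) (x : Plane)
    {v : Plane} (hv : ‖v‖ ≤ 1) :
    ‖fderiv ℝ (mollify n m) x v‖ ≤ C / scale n ^ 9 *
      ∫ t in Metric.closedBall 0 (2 * scale n ^ 3), ‖m (x - t) - m x‖ := by
  have hb : ∀ x, ‖m x‖ ≤ 1 := fun x => (h1 x).le
  have hcont : Continuous fun t => fderiv ℝ (mollifier n) t v :=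
    ((contDiff_mollifier n).continuous_fderiv (by norm_num)).clm_apply continuous_const
  have hcs : HasCompactSupport fun t => fderiv ℝ (mollifier n) t v :=
    (hasCompactSupport_mollifier n).fderiv_apply ℝ v
  have hI : Integrable fun t => fderiv ℝ (mollifier n) t v :=
    hcont.integrable_of_hasCompactSupport hcs
  have e : fderiv ℝ (mollify n m) x v
      = ∫ t, fderiv ℝ (mollifier n) t v • (m (x - t) - m x) := by
    simp only [smul_sub]
    rw [integral_sub _ (hI.smul_const _), integral_fderiv_mollifier_smul, sub_zero,
      fderiv_mollify hm hb]
    exact hI.smul_bdd 1 (hm.comp (measurable_const.sub measurable_id)).aestronglyMeasurable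
      (ae_of_all _ fun _ => hb _)
  have hvan : ∀ t, t ∉ Metric.closedBall (0 : Plane) (2 * scale n ^ 3) →
      fderiv ℝ (mollifier n) t v • (m (x - t) - m x) = 0 := by
    intro t ht
    rw [← tsupport_mollifier] at ht
    have : fderiv ℝ (mollifier n) t = 0 :=
      image_eq_zero_of_notMem_tsupport fun h => ht (tsupport_fderiv_subset ℝ h)
    rw [this]; simp
  rw [e, ← setIntegral_eq_integral_of_forall_compl_eq_zero hvan, ← integral_const_mul]
  refine norm_integral_le_of_norm_le ?_ (ae_of_all _ fun t => ?_)
  · simpa using (integrableOn_shift_pow hm h1 x 1 (2 * scale n ^ 3)).const_mul (C / scale n ^ 9)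
  · rw [norm_smul]
    refine mul_le_mul_of_nonneg_right ?_ (norm_nonneg _)
    refine (ContinuousLinearMap.le_opNorm _ _).trans ?_
    exact (mul_le_of_le_one_right (norm_nonneg _) hv).trans (hC t)

theorem sq_mul_le_add_pow_three {x y : ℝ} (hx : 0 ≤ x) (hy : 0 ≤ y) :
    x ^ 2 * y ≤ x ^ 3 + y ^ 3 := by
  rcases le_total x y with h | h
  · have := mul_le_mul_of_nonneg_right (pow_le_pow_left₀ hx h 2) hy
    nlinarith [pow_nonneg hx 3]
  · have := mul_le_mul_of_nonneg_left h (pow_nonneg hx 2)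
    nlinarith [pow_nonneg hy 3]

theorem integral_sq_mul_integral_le {α : Type*} [MeasurableSpace α] {μ : Measure α}
    [IsFiniteMeasure μ] {d : α → ℝ} (hd : ∀ x, 0 ≤ d x) (h1 : Integrable d μ)
    (h2 : Integrable (fun x => d x ^ 2) μ) (h3 : Integrable (fun x => d x ^ 3) μ) :
    (∫ x, d x ^ 2 ∂μ) * (∫ x, d x ∂μ) ≤ 2 * μ.real univ * ∫ x, d x ^ 3 ∂μ := by
  have hin : ∀ x, d x ^ 2 * (∫ y, d y ∂μ) ≤ μ.real univ * d x ^ 3 + ∫ y, d y ^ 3 ∂μ := by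
    intro x
    rw [← integral_const_mul]
    calc ∫ y, d x ^ 2 * d y ∂μ ≤ ∫ y, (d x ^ 3 + d y ^ 3) ∂μ :=
          integral_mono (h1.const_mul _) ((integrable_const _).add h3)
            fun y => sq_mul_le_add_pow_three (hd x) (hd y)
      _ = _ := by rw [integral_add (integrable_const _) h3, integral_const, smul_eq_mul]
  rw [← integral_mul_const]
  calc ∫ x, d x ^ 2 * (∫ y, d y ∂μ) ∂μ
      ≤ ∫ x, (μ.real univ * d x ^ 3 + ∫ y, d y ^ 3 ∂μ) ∂μ :=
        integral_mono (h2.mul_const _) ((h3.const_mul _).add (integrable_const _)) hin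
    _ = _ := by
        rw [integral_add (h3.const_mul _) (integrable_const _), integral_const, smul_eq_mul,
          integral_const_mul]
        ring

/-- The pointwise commutator bound: `1 - |M|²` is quadratic and `DM` is linear in the finite
differences of `m`, so their product is cubic. -/
theorem exists_commutator_pointwise_bound {m : Plane → ℂ} (hm : Measurable m)
    (h1 : ∀ x, ‖m x‖ = 1) :
    ∃ C : ℝ, 0 ≤ C ∧ ∀ (n : ℕ) (x v : Plane), ‖v‖ ≤ 1 →
      (1 - ‖mollify n m x‖ ^ 2) * ‖fderiv ℝ (mollify n m) x v‖ ≤ C / scale n ^ 9 *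
        ∫ t in Metric.closedBall 0 (2 * scale n ^ 3), ‖m (x - t) - m x‖ ^ 3 := by
  obtain ⟨C, hC0, hC⟩ := exists_mollifier_bounds
  set v1 := volume.real (Metric.closedBall (0 : Plane) 1) with hv1
  refine ⟨8 * C ^ 2 * v1, by positivity, fun n x v hv => ?_⟩
  have hs := scale_pos n
  have hA := one_sub_norm_mollify_sq_le hm h1 (fun y => (hC n y).1) x
  have hB := norm_fderiv_mollify_le hm h1 (fun y => (hC n y).2) x hv
  set B := Metric.closedBall (0 : Plane) (2 * scale n ^ 3) with hBdef
  have : IsFiniteMeasure (volume.restrict B) :=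
    ⟨by rw [Measure.restrict_apply_univ]; exact measure_closedBall_lt_top⟩
  have hvol : (volume.restrict B).real univ = 4 * scale n ^ 6 * v1 := by
    rw [measureReal_restrict_apply_univ, hBdef, volume_real_closedBall _ (by positivity)]
    ring
  have hP := integral_sq_mul_integral_le (μ := volume.restrict B)
    (d := fun t => ‖m (x - t) - m x‖) (fun t => norm_nonneg _)
    (by simpa [IntegrableOn] using integrableOn_shift_pow hm h1 x 1 (2 * scale n ^ 3))
    (integrableOn_shift_pow hm h1 x 2 (2 * scale n ^ 3))
    (integrableOn_shift_pow hm h1 x 3 (2 * scale n ^ 3))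
  rw [hvol] at hP
  have hI2 : 0 ≤ ∫ t in B, ‖m (x - t) - m x‖ ^ 2 := integral_nonneg fun t => sq_nonneg _
  calc (1 - ‖mollify n m x‖ ^ 2) * ‖fderiv ℝ (mollify n m) x v‖
      ≤ (C / scale n ^ 6 * ∫ t in B, ‖m (x - t) - m x‖ ^ 2) *
        (C / scale n ^ 9 * ∫ t in B, ‖m (x - t) - m x‖) :=
        mul_le_mul hA hB (norm_nonneg _) (by positivity)
    _ = C ^ 2 / scale n ^ 15 * ((∫ t in B, ‖m (x - t) - m x‖ ^ 2) *
        ∫ t in B, ‖m (x - t) - m x‖) := by field_simp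
    _ ≤ C ^ 2 / scale n ^ 15 * (2 * (4 * scale n ^ 6 * v1) *
        ∫ t in B, ‖m (x - t) - m x‖ ^ 3) := mul_le_mul_of_nonneg_left hP (by positivity)
    _ = _ := by field_simp; ring

/-- The weighted `L^{4/3}` bound on the commutator, in the dual form obtained from Young's
inequality: integrated against `a`, it is controlled by the fourth power of `a`. The Besov
regularity enters through the fourth powers of the finite differences, and its exponent `1/3`
exactly compensates the loss of one derivative. -/
theorem IsEikonal.exists_commutator_bound {U U' : Set Plane} {m : Plane → ℂ} {r : ℝ}
    (hm : IsEikonal U m) (hU : ∀ x ∈ U', ∀ y, ‖y‖ ≤ r → x + y ∈ U)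
    {η : Plane → ℝ} (hη : IsTest U' η) (hη0 : ∀ x, 0 ≤ η x) (hη1 : ∀ x, η x ≤ 1) :
    ∃ C : ℝ, 0 ≤ C ∧ ∀ (n : ℕ) (κ A : ℝ) (a : Plane → ℝ) (v : Plane), 2 * scale n ^ 3 < r →
      0 < κ → Measurable a → (∀ x, 0 ≤ a x) → (∀ x, a x ≤ A) → ‖v‖ ≤ 1 →
      ∫ x, η x ^ 4 * (a x * ((1 - ‖mollify n m x‖ ^ 2) * ‖fderiv ℝ (mollify n m) x v‖))
        ≤ C * (κ ^ 4 + (κ⁻¹) ^ 12 * ∫ x, η x ^ 4 * a x ^ 4) := by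
  obtain ⟨C₁, hC₁, hshift⟩ := hm.exists_shift_bound hU hη hη0 hη1
  obtain ⟨C₂, hC₂, hpt⟩ := exists_commutator_pointwise_bound hm.measurable hm.norm_eq_one
  set v1 := volume.real (Metric.closedBall (0 : Plane) 1) with hv1
  refine ⟨C₂ * 4 * v1 * (16 * C₁ + 1), by positivity,
    fun n κ A a v hnr hκ ham ha0 haA hv => ?_⟩
  have hs := scale_pos n
  set s := scale n with hsdef
  set B := Metric.closedBall (0 : Plane) (2 * s ^ 3) with hBdef
  have : IsFiniteMeasure (volume.restrict B) :=
    ⟨by rw [Measure.restrict_apply_univ]; exact measure_closedBall_lt_top⟩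
  have hvol : (volume.restrict B).real univ = 4 * s ^ 6 * v1 := by
    rw [measureReal_restrict_apply_univ, hBdef, volume_real_closedBall _ (by positivity)]
    ring
  have hηc : Continuous fun x => η x ^ 4 := hη.contDiff.continuous.pow 4
  have hηs : HasCompactSupport fun x => η x ^ 4 := by
    have : (fun x => η x ^ 4) = fun x => η x * η x ^ 3 := by funext x; ring
    rw [this]; exact hη.hasCompactSupport.mul_right
  have hηI : Integrable fun x => η x ^ 4 := hηc.integrable_of_hasCompactSupport hηs
  have hη4 : ∀ x, 0 ≤ η x ^ 4 := fun x => pow_nonneg (hη0 x) 4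
  have haI : Integrable fun x => η x ^ 4 * a x ^ 4 :=
    integrable_mul_of_bounded (𝕜 := ℝ) (C := A ^ 4) hηc hηs (ham.pow_const 4).aestronglyMeasurable
      fun x => by
        rw [Real.norm_of_nonneg (pow_nonneg (ha0 x) 4)]
        exact pow_le_pow_left₀ (ha0 x) (haA x) 4
  have hprod : Integrable (Function.uncurry fun x t => η x ^ 4 * ‖m (x - t) - m x‖ ^ 4)
      (volume.prod (volume.restrict B)) := by
    have hdom : Integrable (fun p : Plane × Plane => (η p.1 ^ 4) * (16 : ℝ))
        (volume.prod (volume.restrict B)) :=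
      hηI.mul_prod (integrable_const (16 : ℝ))
    refine hdom.mono ?_ (ae_of_all _ fun p => ?_)
    · refine Measurable.aestronglyMeasurable ?_
      have h1 : Measurable fun p : Plane × Plane => m (p.1 - p.2) :=
        hm.measurable.comp (measurable_fst.sub measurable_snd)
      exact (hηc.measurable.comp measurable_fst).mul
        ((h1.sub (hm.measurable.comp measurable_fst)).norm.pow_const 4)
    · simp only [Function.uncurry, norm_mul, norm_pow, norm_norm]
      refine mul_le_mul_of_nonneg_left ?_ (by positivity)
      calc _ ≤ (2 : ℝ) ^ 4 :=
            pow_le_pow_left₀ (norm_nonneg _) (norm_sub_le_two hm.norm_eq_one _ _) 4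
        _ = _ := by norm_num
  have hfub : ∫ x, ∫ t in B, η x ^ 4 * ‖m (x - t) - m x‖ ^ 4
      ≤ 4 * s ^ 6 * v1 * (16 * C₁ * s ^ 4) := by
    rw [integral_integral_swap hprod]
    have hin : ∀ t ∈ B, ∫ x, η x ^ 4 * ‖m (x - t) - m x‖ ^ 4 ≤ 16 * C₁ * s ^ 4 := by
      intro t ht
      have htn : ‖t‖ ≤ 2 * s ^ 3 := by simpa [hBdef] using ht
      set k : ℝ := ‖t‖ ^ ((1 : ℝ) / 3) with hk
      have hk0 : 0 ≤ k := Real.rpow_nonneg (norm_nonneg _) _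
      have hk3 : k ^ 3 = ‖t‖ := by
        rw [hk, ← Real.rpow_natCast, ← Real.rpow_mul (norm_nonneg _)]
        norm_num
      have hks : k ≤ 2 * s := by
        refine le_of_pow_le_pow_left₀ (n := 3) (by norm_num) (by positivity) ?_
        rw [hk3, mul_pow]
        have : 0 < s ^ 3 := by positivity
        linarith
      have h2 := hshift (-t) k hk0 (by rw [norm_neg, hk3]) (by rw [norm_neg]; linarith)
      simp only [← sub_eq_add_neg] at h2
      refine h2.trans ?_
      calc C₁ * k ^ 4 ≤ C₁ * (2 * s) ^ 4 :=
            mul_le_mul_of_nonneg_left (pow_le_pow_left₀ hk0 hks 4) hC₁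
        _ = _ := by ring
    calc ∫ t in B, ∫ x, η x ^ 4 * ‖m (x - t) - m x‖ ^ 4
        ≤ ∫ _ in B, 16 * C₁ * s ^ 4 :=
          setIntegral_mono_on hprod.integral_prod_right (integrable_const _)
            measurableSet_closedBall hin
      _ = _ := by rw [integral_const, hvol, smul_eq_mul]
  have hI1 : Integrable fun x => ∫ t in B, η x ^ 4 * ‖m (x - t) - m x‖ ^ 4 :=
    hprod.integral_prod_left
  have hpoint : ∀ x, η x ^ 4 *
      (a x * ((1 - ‖mollify n m x‖ ^ 2) * ‖fderiv ℝ (mollify n m) x v‖)) ≤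
      C₂ * κ ^ 4 / s ^ 10 * (∫ t in B, η x ^ 4 * ‖m (x - t) - m x‖ ^ 4)
        + C₂ * 4 * v1 * (κ⁻¹) ^ 12 * (η x ^ 4 * a x ^ 4) := by
    intro x
    have hin : a x * (∫ t in B, ‖m (x - t) - m x‖ ^ 3) ≤
        κ ^ 4 / s * (∫ t in B, ‖m (x - t) - m x‖ ^ 4)
          + 4 * s ^ 9 * v1 * ((κ⁻¹) ^ 12 * a x ^ 4) := by
      rw [← integral_const_mul, ← integral_const_mul]
      calc ∫ t in B, a x * ‖m (x - t) - m x‖ ^ 3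
          ≤ ∫ t in B, (κ ^ 4 / s * ‖m (x - t) - m x‖ ^ 4 + s ^ 3 * ((κ⁻¹) ^ 12 * a x ^ 4)) := by
            refine integral_mono ((integrableOn_shift_pow hm.measurable hm.norm_eq_one x 3
              (2 * s ^ 3)).const_mul _) (((integrableOn_shift_pow hm.measurable hm.norm_eq_one x 4
              (2 * s ^ 3)).const_mul _).add (integrable_const _)) fun t => ?_
            -- Young's inequality with weights adapted to the scale `s` of the mollification
            have hy := pow_three_mul_le (x := κ * s⁻¹ * ‖m (x - t) - m x‖)
              (y := (κ⁻¹) ^ 3 * a x) (by positivity) (mul_nonneg (by positivity) (ha0 x))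
            have hy' := mul_le_mul_of_nonneg_left hy (pow_nonneg hs.le 3)
            convert hy' using 1
            · field_simp
            · field_simp
        _ = _ := by
            rw [integral_add ((integrableOn_shift_pow hm.measurable hm.norm_eq_one x 4
              (2 * s ^ 3)).const_mul _) (integrable_const _), integral_const, hvol, smul_eq_mul]
            ring
    have hp := hpt n x v hv
    calc η x ^ 4 * (a x * ((1 - ‖mollify n m x‖ ^ 2) * ‖fderiv ℝ (mollify n m) x v‖))
        ≤ η x ^ 4 * (a x * (C₂ / s ^ 9 * ∫ t in B, ‖m (x - t) - m x‖ ^ 3)) :=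
          mul_le_mul_of_nonneg_left (mul_le_mul_of_nonneg_left hp (ha0 x)) (hη4 x)
      _ = η x ^ 4 * (C₂ / s ^ 9 * (a x * ∫ t in B, ‖m (x - t) - m x‖ ^ 3)) := by ring
      _ ≤ η x ^ 4 * (C₂ / s ^ 9 * (κ ^ 4 / s * (∫ t in B, ‖m (x - t) - m x‖ ^ 4)
          + 4 * s ^ 9 * v1 * ((κ⁻¹) ^ 12 * a x ^ 4))) :=
          mul_le_mul_of_nonneg_left (mul_le_mul_of_nonneg_left hin (by positivity)) (hη4 x)
      _ = _ := by
          rw [integral_const_mul]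
          field_simp
  have hone : ∀ x, 0 ≤ 1 - ‖mollify n m x‖ ^ 2 := fun x => by
    have := norm_mollify_le (fun x => (hm.norm_eq_one x).le) n x
    nlinarith [norm_nonneg (mollify n m x)]
  have hfinal := integral_mono_of_nonneg
    (ae_of_all _ fun x => mul_nonneg (hη4 x) (mul_nonneg (ha0 x)
      (mul_nonneg (hone x) (norm_nonneg (fderiv ℝ (mollify n m) x v)))))
    ((hI1.const_mul (C₂ * κ ^ 4 / s ^ 10)).add (haI.const_mul (C₂ * 4 * v1 * (κ⁻¹) ^ 12)))
    (ae_of_all _ hpoint)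
  refine hfinal.trans ?_
  simp only [Pi.add_apply]
  rw [integral_add (hI1.const_mul _) (haI.const_mul _), integral_const_mul, integral_const_mul]
  have hT : 0 ≤ ∫ x, η x ^ 4 * a x ^ 4 :=
    integral_nonneg fun x => mul_nonneg (hη4 x) (pow_nonneg (ha0 x) 4)
  have h3 := mul_le_mul_of_nonneg_left hfub
    (by positivity : 0 ≤ C₂ * κ ^ 4 / s ^ 10)
  have h4 : C₂ * κ ^ 4 / s ^ 10 * (4 * s ^ 6 * v1 * (16 * C₁ * s ^ 4))
      = C₂ * 4 * v1 * (16 * C₁) * κ ^ 4 := by field_simp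
  have h5 : 0 ≤ C₂ * 4 * v1 * κ ^ 4 := by positivity
  have h6 : 0 ≤ C₂ * 4 * v1 * (16 * C₁) * ((κ⁻¹) ^ 12 * ∫ x, η x ^ 4 * a x ^ 4) := by positivity
  nlinarith

/-! ### Wirtinger derivatives and the entropy identity -/

/-- The Wirtinger derivative `∂φ/∂z = (∂₁φ - i ∂₂φ) / 2`. -/
def dz (φ : Plane → ℂ) (x : Plane) : ℂ :=
  (fderiv ℝ φ x e₁ - Complex.I * fderiv ℝ φ x e₂) / 2

/-- The Wirtinger derivative `∂φ/∂z̄ = (∂₁φ + i ∂₂φ) / 2`. -/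
def dzbar (φ : Plane → ℂ) (x : Plane) : ℂ :=
  (fderiv ℝ φ x e₁ + Complex.I * fderiv ℝ φ x e₂) / 2

theorem IsTest.continuous_dz {U : Set Plane} {φ : Plane → ℂ} (hφ : IsTest U φ) :
    Continuous (dz φ) :=
  ((hφ.continuous_fderiv e₁).sub (continuous_const.mul (hφ.continuous_fderiv e₂))).div_const _

theorem IsTest.continuous_dzbar {U : Set Plane} {φ : Plane → ℂ} (hφ : IsTest U φ) :
    Continuous (dzbar φ) :=
  ((hφ.continuous_fderiv e₁).add (continuous_const.mul (hφ.continuous_fderiv e₂))).div_const _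

theorem IsTest.hasCompactSupport_dz {U : Set Plane} {φ : Plane → ℂ} (hφ : IsTest U φ) :
    HasCompactSupport (dz φ) := by
  refine (hφ.hasCompactSupport.fderiv ℝ).mono fun x hx => ?_
  contrapose! hx
  simp only [Function.mem_support, not_not] at hx ⊢
  simp [dz, hx]

theorem IsTest.hasCompactSupport_dzbar {U : Set Plane} {φ : Plane → ℂ} (hφ : IsTest U φ) :
    HasCompactSupport (dzbar φ) := by
  refine (hφ.hasCompactSupport.fderiv ℝ).mono fun x hx => ?_
  contrapose! hx
  simp only [Function.mem_support, not_not] at hx ⊢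
  simp [dzbar, hx]

theorem integral_fderiv_eq_zero {U : Set Plane} {φ : Plane → ℂ} (hφ : IsTest U φ) (v : Plane) :
    ∫ x, fderiv ℝ φ x v = 0 := by
  have h1 : Integrable fun x => fderiv ℝ φ x v :=
    (hφ.continuous_fderiv v).integrable_of_hasCompactSupport (hφ.hasCompactSupport_fderiv v)
  have h2 : Integrable φ := hφ.contDiff.continuous.integrable_of_hasCompactSupport
    hφ.hasCompactSupport
  have := integral_mul_fderiv_eq_neg_fderiv_mul_of_integrable (μ := (volume : Measure Plane))
    (f := fun _ => (1 : ℂ)) (g := φ) (v := v) (by simp) (by simpa using h1)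
    (by simpa using h2) (fun x _ => differentiableAt_const _) (fun x _ => hφ.differentiable x)
  simpa using this

theorem integral_dzbar_add_dz_eq_zero {U : Set Plane} {φ ψ : Plane → ℂ} (hφ : IsTest U φ)
    (hψ : IsTest U ψ) : ∫ x, (dzbar φ x + dz ψ x) = 0 := by
  have hI : ∀ {φ : Plane → ℂ}, IsTest U φ → ∀ v, Integrable fun x => fderiv ℝ φ x v :=
    fun hφ v =>
      (hφ.continuous_fderiv v).integrable_of_hasCompactSupport (hφ.hasCompactSupport_fderiv v)
  have h1 : ∫ x, dzbar φ x = 0 := by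
    simp only [dzbar]
    rw [integral_div, integral_add (hI hφ e₁) ((hI hφ e₂).const_mul _), integral_const_mul,
      integral_fderiv_eq_zero hφ, integral_fderiv_eq_zero hφ]
    simp
  have h2 : ∫ x, dz ψ x = 0 := by
    simp only [dz]
    rw [integral_div, integral_sub (hI hψ e₁) ((hI hψ e₂).const_mul _), integral_const_mul,
      integral_fderiv_eq_zero hψ, integral_fderiv_eq_zero hψ]
    simp
  rw [integral_add (hφ.continuous_dzbar.integrable_of_hasCompactSupport hφ.hasCompactSupport_dzbar)
    (hψ.continuous_dz.integrable_of_hasCompactSupport hψ.hasCompactSupport_dz), h1, h2, add_zero]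

/-- For smooth curl-free `M`, the entropy production associated with the Fourier mode `k + 2` is
`M ^ k` times the single quantity `(1 - |M|²) ∂M/∂z̄`, for a suitable extension of the entropy off
the unit circle. -/
theorem integral_entropy_identity {U : Set Plane} {M : Plane → ℂ} (hM : ContDiff ℝ ∞ M)
    (hcurl : ∀ x ∈ U, (fderiv ℝ M x e₁).im = (fderiv ℝ M x e₂).re)
    {φ : Plane → ℂ} (hφ : IsTest U φ) (k : ℕ) :
    ∫ x, (dzbar φ x * ((k + 3) * M x ^ (k + 1) * (1 + (k + 1) * (1 - M x * conj (M x))))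
        + dz φ x * ((k + 1) * M x ^ (k + 3)))
      = -((k + 1) * (k + 2) * (k + 3)) *
        ∫ x, φ x * (M x ^ k * ((1 - M x * conj (M x)) * dzbar M x)) := by
  set Y : Plane → ℂ :=
    fun x => (k + 3) * M x ^ (k + 1) * (1 + (k + 1) * (1 - M x * conj (M x))) with hY
  set Z : Plane → ℂ := fun x => (k + 1) * M x ^ (k + 3) with hZ
  have hconj : ContDiff ℝ ∞ fun x => conj (M x) := Complex.conjCLE.contDiff.comp hM
  have hYs : ContDiff ℝ ∞ Y :=
    (contDiff_const.mul (hM.pow _)).mul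
      (contDiff_const.add (contDiff_const.mul (contDiff_const.sub (hM.mul hconj))))
  have hZs : ContDiff ℝ ∞ Z := contDiff_const.mul (hM.pow _)
  have hMd : ∀ x, HasFDerivAt M (fderiv ℝ M x) x := fun x =>
    (hM.differentiable (by norm_num)).differentiableAt.hasFDerivAt
  have hMc : ∀ x, HasFDerivAt (fun x => conj (M x))
      ((Complex.conjCLE : ℂ →L[ℝ] ℂ).comp (fderiv ℝ M x)) x := fun x =>
    (Complex.conjCLE : ℂ →L[ℝ] ℂ).hasFDerivAt.comp x (hMd x)
  have hYd : ∀ x v, fderiv ℝ Y x v = (k + 3) * ((k + 1) * M x ^ k * fderiv ℝ M x v) *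
      (1 + (k + 1) * (1 - M x * conj (M x))) - (k + 3) * M x ^ (k + 1) * ((k + 1) *
        (fderiv ℝ M x v * conj (M x) + M x * conj (fderiv ℝ M x v))) := by
    intro x v
    have h := (((hMd x).pow (k + 1)).const_mul ((k : ℂ) + 3)).mul
      ((((((hMd x).mul (hMc x)).const_sub 1).const_mul ((k : ℂ) + 1))).const_add 1)
    have h' : fderiv ℝ Y x = _ := h.fderiv
    rw [h']
    simp
    ring
  have hZd : ∀ x v, fderiv ℝ Z x v = (k + 1) * ((k + 3) * M x ^ (k + 2) * fderiv ℝ M x v) := by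
    intro x v
    have h := ((hMd x).pow (k + 3)).const_mul ((k : ℂ) + 1)
    have h' : fderiv ℝ Z x = _ := h.fderiv
    rw [h']
    simp
  have hpt : ∀ x, dzbar (fun x => φ x * Y x) x + dz (fun x => φ x * Z x) x =
      (dzbar φ x * Y x + dz φ x * Z x) + ((k + 1) * (k + 2) * (k + 3)) *
        (φ x * (M x ^ k * ((1 - M x * conj (M x)) * dzbar M x))) := by
    intro x
    have hp : ∀ {G : Plane → ℂ}, ContDiff ℝ ∞ G → ∀ v, fderiv ℝ (fun x => φ x * G x) x v
        = φ x * fderiv ℝ G x v + G x * fderiv ℝ φ x v := by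
      intro G hG v
      rw [fderiv_fun_mul hφ.differentiable.differentiableAt
        (hG.differentiable (by norm_num)).differentiableAt]
      simp
    simp only [dzbar, dz]
    rw [hp hYs, hp hYs, hp hZs, hp hZs]
    by_cases hx : x ∈ U
    · have hc : fderiv ℝ M x e₁ - Complex.I * fderiv ℝ M x e₂
          = conj (fderiv ℝ M x e₁) + Complex.I * conj (fderiv ℝ M x e₂) := by
        have := hcurl x hx
        apply Complex.ext
        · simp
        · simp; linarith
      rw [hYd, hYd, hZd, hZd]
      simp only [hY, hZ]
      linear_combination (φ x * (k + 1) * (k + 3) * M x ^ (k + 2) / 2) * hc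
    · have : φ x = 0 := image_eq_zero_of_notMem_tsupport fun hx' => hx (hφ.3 hx')
      rw [this]; ring
  have h0 := integral_dzbar_add_dz_eq_zero (hφ.mul hYs) (hφ.mul hZs)
  simp only [hpt] at h0
  have hdM : Continuous fun x => dzbar M x := by
    have hc : ∀ v, Continuous fun x => fderiv ℝ M x v := fun v =>
      (hM.continuous_fderiv (by norm_num)).clm_apply continuous_const
    exact ((hc e₁).add (continuous_const.mul (hc e₂))).div_const _
  have hI1 : Integrable fun x => dzbar φ x * Y x + dz φ x * Z x :=
    ((hφ.continuous_dzbar.mul hYs.continuous).integrable_of_hasCompactSupport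
      hφ.hasCompactSupport_dzbar.mul_right).add
    ((hφ.continuous_dz.mul hZs.continuous).integrable_of_hasCompactSupport
      hφ.hasCompactSupport_dz.mul_right)
  have hI2 : Integrable fun x => φ x * (M x ^ k * ((1 - M x * conj (M x)) * dzbar M x)) :=
    (hφ.contDiff.continuous.mul ((hM.continuous.pow k).mul ((continuous_const.sub
      (hM.continuous.mul hconj.continuous)).mul hdM))).integrable_of_hasCompactSupport
      hφ.hasCompactSupport.mul_right
  rw [integral_add hI1 (hI2.const_mul _), integral_const_mul] at h0
  linear_combination h0

/-! ### Vanishing of the entropy productions -/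

/-- A cutoff function for a compact subset of `U`, supported in a set `U'` whose translates by
vectors of length at most `r` stay in `U`. -/
theorem exists_cutoff {U K : Set Plane} (hU : IsOpen U) (hK : IsCompact K) (hKU : K ⊆ U) :
    ∃ (U' : Set Plane) (r : ℝ) (η : Plane → ℝ), 0 < r ∧ K ⊆ U' ∧
      (∀ x ∈ U', ∀ y, ‖y‖ ≤ r → x + y ∈ U) ∧ IsTest U' η ∧ (∀ x, 0 ≤ η x) ∧ (∀ x, η x ≤ 1) ∧
      ∀ x ∈ K, η x = 1 := by
  obtain ⟨δ, hδ, hδU⟩ := hK.exists_cthickening_subset_open hU hKU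
  have hδ2 : 0 < δ / 2 := by positivity
  have hint : K ⊆ interior (Metric.cthickening (δ / 2) K) :=
    (Metric.self_subset_thickening hδ2 K).trans
      (Metric.thickening_subset_interior_cthickening _ _)
  obtain ⟨f, hf1, hf0, hf⟩ := exists_contMDiffMap_one_nhds_of_subset_interior
    (modelWithCornersSelf ℝ Plane) (n := (⊤ : ℕ∞)) hK.isClosed hint
  have hsupp : tsupport f ⊆ Metric.cthickening (δ / 2) K :=
    closure_minimal (fun x hx => by by_contra h; exact hx (hf0 x h)) Metric.isClosed_cthickening
  refine ⟨Metric.cthickening (δ / 2) K, δ / 2, f, hδ2, Metric.self_subset_cthickening K, ?_,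
    ⟨contMDiff_iff_contDiff.1 f.contMDiff, hK.cthickening.of_isClosed_subset
      (isClosed_tsupport _) hsupp, hsupp⟩, fun x => (hf x).1, fun x => (hf x).2,
    fun x hx => hf1.self_of_nhdsSet x hx⟩
  intro x hx y hy
  refine hδU ?_
  have := Metric.cthickening_cthickening_subset hδ2.le hδ2.le K
    (Metric.mem_cthickening_of_dist_le (x + y) x _ _ hx (by simpa [dist_eq_norm] using hy))
  simpa using this

theorem tendsto_integral_mul_comp_mollify {m : Plane → ℂ} (hm : Measurable m)
    (hb : ∀ x, ‖m x‖ ≤ 1) {ψ : Plane → ℂ} (hψ : Continuous ψ) (hψc : HasCompactSupport ψ)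
    {G : ℂ → ℂ} (hG : Continuous G) :
    Tendsto (fun n => ∫ x, ψ x * G (mollify n m x)) atTop (𝓝 (∫ x, ψ x * G (m x))) := by
  obtain ⟨C, hC⟩ := (isCompact_closedBall (0 : ℂ) 1).exists_bound_of_continuousOn hG.continuousOn
  refine tendsto_integral_of_dominated_convergence (fun x => ‖ψ x‖ * C) (fun n => ?_) ?_
    (fun n => ae_of_all _ fun x => ?_) ?_
  · exact (hψ.mul (hG.comp (contDiff_mollify hm hb n).continuous)).aestronglyMeasurable
  · exact (hψ.integrable_of_hasCompactSupport hψc).norm.mul_const C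
  · rw [norm_mul]
    exact mul_le_mul_of_nonneg_left (hC _ (by simpa using norm_mollify_le hb n x)) (norm_nonneg _)
  · filter_upwards [ae_tendsto_mollify hm hb] with x hx
    exact ((hG.tendsto _).comp hx).const_mul _

theorem mollify_const_mul (n : ℕ) (c : ℂ) (g : Plane → ℂ) :
    mollify n (fun x => c * g x) = fun x => c * mollify n g x := by
  funext x
  rw [mollify_apply, mollify_apply, ← integral_const_mul]
  congr 1
  funext t
  rw [mul_smul_comm]

theorem IsEikonal.curl_mollify {U : Set Plane} {m : Plane → ℂ} (hm : IsEikonal U m) {n : ℕ}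
    {x : Plane} (hx : Metric.closedBall x (2 * scale n ^ 3) ⊆ U) :
    (fderiv ℝ (mollify n m) x e₁).im = (fderiv ℝ (mollify n m) x e₂).re := by
  have h := div_mollify_eq_zero (V := fun x => Complex.I * m x)
    (measurable_const.mul hm.measurable) (C := 1)
    (fun x => by rw [norm_mul, Complex.norm_I, hm.norm_eq_one, one_mul]) hm.curl hx
  have hd : Differentiable ℝ (mollify n m) :=
    (contDiff_mollify hm.measurable (fun x => (hm.norm_eq_one x).le) n).differentiable
      (by norm_num)
  rw [mollify_const_mul, fderiv_const_mul hd.differentiableAt] at h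
  simp at h
  linarith

/-- The two entropy hypotheses combined into a single complex equation,
`3 ∂m/∂z̄ + ∂m³/∂z = 0`. -/
theorem IsEikonal.integral_mode_two {U : Set Plane} {m : Plane → ℂ} (hm : IsEikonal U m)
    {φ : Plane → ℂ} (hφ : IsTest U φ) :
    ∫ x, (dzbar φ x * (3 * m x) + dz φ x * m x ^ 3) = 0 := by
  have hre : IsTest U fun x => (φ x).re :=
    ⟨Complex.reCLM.contDiff.comp hφ.1, hφ.2.comp_left (g := Complex.re) rfl,
      (closure_mono (Function.support_comp_subset (g := Complex.re) rfl φ)).trans hφ.3⟩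
  have him : IsTest U fun x => (φ x).im :=
    ⟨Complex.imCLM.contDiff.comp hφ.1, hφ.2.comp_left (g := Complex.im) rfl,
      (closure_mono (Function.support_comp_subset (g := Complex.im) rfl φ)).trans hφ.3⟩
  have hder : ∀ x v, fderiv ℝ φ x v = (fderiv ℝ (fun x => (φ x).re) x v : ℂ)
      + Complex.I * (fderiv ℝ (fun x => (φ x).im) x v : ℂ) := by
    intro x v
    have h1 := (Complex.reCLM.hasFDerivAt.comp x (hφ.differentiable x).hasFDerivAt).fderiv
    have h2 := (Complex.imCLM.hasFDerivAt.comp x (hφ.differentiable x).hasFDerivAt).fderiv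
    have e1 : fderiv ℝ (fun x => (φ x).re) x v = (fderiv ℝ φ x v).re := by
      change fderiv ℝ (Complex.reCLM ∘ φ) x v = _
      rw [h1]; rfl
    have e2 : fderiv ℝ (fun x => (φ x).im) x v = (fderiv ℝ φ x v).im := by
      change fderiv ℝ (Complex.imCLM ∘ φ) x v = _
      rw [h2]; rfl
    rw [e1, e2, mul_comm]
    exact (Complex.re_add_im _).symm
  set V : Plane → ℂ := fun x => 3 * conj (m x) + m x ^ 3 with hV
  set W : Plane → ℂ := fun x => Complex.I * (3 * conj (m x) - m x ^ 3) with hW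
  have hVm : Measurable V := by
    have hc : Continuous fun z : ℂ => 3 * conj z + z ^ 3 := by fun_prop
    exact hc.measurable.comp hm.measurable
  have hWm : Measurable W := by
    have hc : Continuous fun z : ℂ => Complex.I * (3 * conj z - z ^ 3) := by fun_prop
    exact hc.measurable.comp hm.measurable
  set p : (Plane → ℂ) → (Plane → ℝ) → Plane → ℝ := fun V ζ x =>
    (V x).re * fderiv ℝ ζ x e₁ + (V x).im * fderiv ℝ ζ x e₂ with hp
  have hI : ∀ {V : Plane → ℂ}, Measurable V → (∀ x, ‖V x‖ ≤ 4) → ∀ {ζ : Plane → ℝ}, IsTest U ζ →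
      Integrable fun x => (p V ζ x : ℂ) :=
    fun hV hb _ hζ => (integrable_divFree_integrand hV hb hζ).ofReal
  have hpt : ∀ x, dzbar φ x * (3 * m x) + dz φ x * m x ^ 3 = (1 / 2 : ℂ) *
      (((p V (fun x => (φ x).re) x : ℂ) + Complex.I * (p W (fun x => (φ x).re) x : ℂ))
      + Complex.I * ((p V (fun x => (φ x).im) x : ℂ) + Complex.I *
        (p W (fun x => (φ x).im) x : ℂ))) := by
    intro x
    have hlin : ∀ ζ : Plane → ℝ, (p V ζ x : ℂ) + Complex.I * (p W ζ x : ℂ)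
        = 3 * m x * (fderiv ℝ ζ x e₁ + Complex.I * fderiv ℝ ζ x e₂)
          + m x ^ 3 * (fderiv ℝ ζ x e₁ - Complex.I * fderiv ℝ ζ x e₂) := by
      intro ζ
      simp only [hp, hV, hW]
      generalize m x ^ 3 = c
      generalize m x = b
      apply Complex.ext
      · simp; ring
      · simp; ring
    rw [hlin, hlin]
    simp only [dzbar, dz]
    rw [hder, hder]
    ring
  have hz : ∀ {V : Plane → ℂ} {ζ : Plane → ℝ}, DivFree U V → IsTest U ζ →
      ∫ x, (p V ζ x : ℂ) = 0 := by
    intro V ζ hV hζ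
    rw [integral_complex_ofReal, Complex.ofReal_eq_zero]
    exact hV ζ hζ
  simp only [hpt]
  rw [integral_const_mul, integral_add, integral_const_mul, integral_add, integral_add,
    integral_const_mul, integral_const_mul, hz hm.sigma hre, hz hm.sigma him, hz hm.sigma' hre,
    hz hm.sigma' him]
  · simp
  · exact hI hVm hm.norm_sigma_le him
  · exact (hI hWm hm.norm_sigma'_le him).const_mul _
  · exact hI hVm hm.norm_sigma_le hre
  · exact (hI hWm hm.norm_sigma'_le hre).const_mul _
  · exact (hI hVm hm.norm_sigma_le hre).add ((hI hWm hm.norm_sigma'_le hre).const_mul _)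
  · exact ((hI hVm hm.norm_sigma_le him).add
      ((hI hWm hm.norm_sigma'_le him).const_mul _)).const_mul _

/-- The commutator `(1 - |M|²) ∂M/∂z̄` of the mollification `M` of `m` at stage `n`. -/
def commutator (n : ℕ) (m : Plane → ℂ) (x : Plane) : ℂ :=
  (1 - mollify n m x * conj (mollify n m x)) * dzbar (mollify n m) x

/-- `integral_entropy_identity` for the mollifications of `m`. They are curl free near the support
of `φ` only once the mollification length is small enough. -/
theorem IsEikonal.eventually_identity {U : Set Plane} (hU : IsOpen U) {m : Plane → ℂ}
    (hm : IsEikonal U m) {φ : Plane → ℂ} (hφ : IsTest U φ) (k : ℕ) :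
    ∀ᶠ n in atTop, ∫ x, (dzbar φ x * ((k + 3) * mollify n m x ^ (k + 1) *
        (1 + (k + 1) * (1 - mollify n m x * conj (mollify n m x))))
        + dz φ x * ((k + 1) * mollify n m x ^ (k + 3)))
      = -((k + 1) * (k + 2) * (k + 3)) *
        ∫ x, φ x * (mollify n m x ^ k * commutator n m x) := by
  obtain ⟨U', r, η, hr, hKU', hU', -⟩ := exists_cutoff hU hφ.hasCompactSupport hφ.tsupport_subset
  have hsmall : ∀ᶠ n in atTop, 2 * scale n ^ 3 < r := by
    have : Tendsto (fun n => 2 * scale n ^ 3) atTop (𝓝 0) := by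
      simpa using (tendsto_scale.pow 3).const_mul 2
    exact this.eventually_lt_const hr
  filter_upwards [hsmall] with n hn
  refine integral_entropy_identity
    (contDiff_mollify hm.measurable (fun x => (hm.norm_eq_one x).le) n) (U := U')
    (fun x hx => hm.curl_mollify fun y hy => ?_) ⟨hφ.1, hφ.2, hKU'⟩ k
  have := hU' x hx (y - x) (by
    rw [Metric.mem_closedBall, dist_eq_norm] at hy; linarith)
  simpa using this

/-- The left-hand side of `integral_entropy_identity` tends to the mode of `m` itself: the factor
`1 - |z|²`, which extends the entropy off the unit circle, vanishes at `z = m`. -/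
theorem IsEikonal.tendsto_mode {U : Set Plane} {m : Plane → ℂ} (hm : IsEikonal U m)
    {φ : Plane → ℂ} (hφ : IsTest U φ) (k : ℕ) :
    Tendsto (fun n => ∫ x, (dzbar φ x * ((k + 3) * mollify n m x ^ (k + 1) *
        (1 + (k + 1) * (1 - mollify n m x * conj (mollify n m x))))
        + dz φ x * ((k + 1) * mollify n m x ^ (k + 3)))) atTop
      (𝓝 (∫ x, (dzbar φ x * ((k + 3) * m x ^ (k + 1)) + dz φ x * ((k + 1) * m x ^ (k + 3))))) := by
  have hb : ∀ x, ‖m x‖ ≤ 1 := fun x => (hm.norm_eq_one x).le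
  have hG1 : Continuous fun z : ℂ =>
      ((k : ℂ) + 3) * z ^ (k + 1) * (1 + (k + 1) * (1 - z * conj z)) := by fun_prop
  have hG2 : Continuous fun z : ℂ => ((k : ℂ) + 1) * z ^ (k + 3) := by fun_prop
  have h1 := tendsto_integral_mul_comp_mollify hm.measurable hb hφ.continuous_dzbar
    hφ.hasCompactSupport_dzbar hG1
  have h2 := tendsto_integral_mul_comp_mollify hm.measurable hb hφ.continuous_dz
    hφ.hasCompactSupport_dz hG2
  have hint : ∀ n, ∀ {ψ : Plane → ℂ} {G : ℂ → ℂ}, Continuous ψ → HasCompactSupport ψ →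
      Continuous G → Integrable fun x => ψ x * G (mollify n m x) := fun n ψ G hψ hψc hG =>
    (hψ.mul (hG.comp
      (contDiff_mollify hm.measurable hb n).continuous)).integrable_of_hasCompactSupport
      hψc.mul_right
  have hint' : ∀ {ψ : Plane → ℂ} {G : ℂ → ℂ}, Continuous ψ → HasCompactSupport ψ →
      Continuous G → Integrable fun x => ψ x * G (m x) := by
    intro ψ G hψ hψc hG
    obtain ⟨C, hC⟩ :=
      (isCompact_closedBall (0 : ℂ) 1).exists_bound_of_continuousOn hG.continuousOn
    exact integrable_mul_of_bounded hψ hψc (hG.measurable.comp hm.measurable).aestronglyMeasurable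
      fun x => hC _ (by simpa using hb x)
  have h3 := h1.add h2
  rw [← integral_add (hint' hφ.continuous_dzbar hφ.hasCompactSupport_dzbar hG1)
    (hint' hφ.continuous_dz hφ.hasCompactSupport_dz hG2)] at h3
  refine (h3.congr fun n => ?_).trans_eq ?_
  · rw [← integral_add (hint n hφ.continuous_dzbar hφ.hasCompactSupport_dzbar hG1)
      (hint n hφ.continuous_dz hφ.hasCompactSupport_dz hG2)]
  · congr 2
    funext x
    rw [Complex.mul_conj', hm.norm_eq_one]
    simp

/-- The case `k = 0` of the entropy identity. Its left-hand side tends to zero by the hypotheses in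
the form `IsEikonal.integral_mode_two`, hence so does the commutator, in the sense of
distributions. -/
theorem IsEikonal.tendsto_commutator {U : Set Plane} (hU : IsOpen U) {m : Plane → ℂ}
    (hm : IsEikonal U m) {φ : Plane → ℂ} (hφ : IsTest U φ) :
    Tendsto (fun n => ∫ x, φ x * commutator n m x) atTop (𝓝 0) := by
  have h1 := hm.tendsto_mode hφ 0
  have h2 := hm.eventually_identity hU hφ 0
  have h0 : ∫ x, (dzbar φ x * (((0 : ℕ) + 3) * m x ^ (0 + 1))
      + dz φ x * (((0 : ℕ) + 1) * m x ^ (0 + 3))) = 0 := by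
    simpa using hm.integral_mode_two hφ
  rw [h0] at h1
  have h3 := (h1.congr' h2).const_mul (-(1 / 6 : ℂ))
  rw [mul_zero] at h3
  refine h3.congr fun n => ?_
  simp only [pow_zero, one_mul]
  push_cast
  ring

theorem norm_sub_pow_four_le (a b c : ℂ) :
    ‖a - b‖ ^ 4 ≤ 8 * (‖a - c‖ ^ 4 + ‖b - c‖ ^ 4) := by
  have h1 : ‖a - b‖ ≤ ‖a - c‖ + ‖b - c‖ := by
    rw [norm_sub_rev b c]; exact norm_sub_le_norm_sub_add_norm_sub a c b
  have h2 := add_pow_le (norm_nonneg (a - c)) (norm_nonneg (b - c)) 4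
  norm_num at h2
  exact (pow_le_pow_left₀ (norm_nonneg _) h1 4).trans h2

theorem tendsto_integral_mollify_pow_sub {m : Plane → ℂ} (hm : Measurable m)
    (hb : ∀ x, ‖m x‖ ≤ 1) {θ : Plane → ℝ} (hθ : Continuous θ) (hθc : HasCompactSupport θ) (k : ℕ) :
    Tendsto (fun n => ∫ x, θ x * ‖mollify n m x ^ k - m x ^ k‖ ^ 4) atTop (𝓝 0) := by
  have h0 : ∫ x, θ x * ‖m x ^ k - m x ^ k‖ ^ 4 = 0 := by simp
  rw [← h0]
  refine tendsto_integral_of_dominated_convergence (fun x => ‖θ x‖ * 2 ^ 4) (fun n => ?_) ?_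
    (fun n => ae_of_all _ fun x => ?_) ?_
  · exact (hθ.measurable.mul ((((contDiff_mollify hm hb n).continuous.measurable.pow_const k).sub
      (hm.pow_const k)).norm.pow_const 4)).aestronglyMeasurable
  · exact (hθ.integrable_of_hasCompactSupport hθc).norm.mul_const _
  · rw [norm_mul, norm_pow, norm_norm]
    refine mul_le_mul_of_nonneg_left (pow_le_pow_left₀ (norm_nonneg _) ?_ 4) (norm_nonneg _)
    refine (norm_sub_le _ _).trans ?_
    rw [norm_pow, norm_pow]
    have h1 := pow_le_one₀ (n := k) (norm_nonneg _) (norm_mollify_le hb n x)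
    have h2 := pow_le_one₀ (n := k) (norm_nonneg _) (hb x)
    linarith
  · filter_upwards [ae_tendsto_mollify hm hb] with x hx
    exact ((((hx.pow k).sub tendsto_const_nhds).norm).pow 4).const_mul _

theorem continuous_commutator {m : Plane → ℂ} (hm : Measurable m) (hb : ∀ x, ‖m x‖ ≤ 1) (n : ℕ) :
    Continuous (commutator n m) := by
  have hM := contDiff_mollify hm hb n
  have hc : ∀ v, Continuous fun x => fderiv ℝ (mollify n m) x v := fun v =>
    (hM.continuous_fderiv (by norm_num)).clm_apply continuous_const
  exact (continuous_const.sub (hM.continuous.mul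
    (Complex.continuous_conj.comp hM.continuous))).mul
    (((hc e₁).add (continuous_const.mul (hc e₂))).div_const _)

theorem norm_commutator_le {m : Plane → ℂ} (hb : ∀ x, ‖m x‖ ≤ 1) (n : ℕ) (x : Plane) :
    ‖commutator n m x‖ ≤ (1 - ‖mollify n m x‖ ^ 2) * ‖fderiv ℝ (mollify n m) x e₁‖
      + (1 - ‖mollify n m x‖ ^ 2) * ‖fderiv ℝ (mollify n m) x e₂‖ := by
  have h1 : (1 - mollify n m x * conj (mollify n m x)) = ((1 - ‖mollify n m x‖ ^ 2 : ℝ) : ℂ) := by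
    rw [Complex.mul_conj']; push_cast; rfl
  have h2 : 0 ≤ 1 - ‖mollify n m x‖ ^ 2 := by
    have := norm_mollify_le hb n x
    nlinarith [norm_nonneg (mollify n m x)]
  have h3 : ‖dzbar (mollify n m) x‖ ≤
      ‖fderiv ℝ (mollify n m) x e₁‖ + ‖fderiv ℝ (mollify n m) x e₂‖ := by
    rw [dzbar, norm_div, Complex.norm_ofNat]
    have := norm_add_le (fderiv ℝ (mollify n m) x e₁)
      (Complex.I * fderiv ℝ (mollify n m) x e₂)
    rw [norm_mul, Complex.norm_I, one_mul] at this
    have h0 := norm_nonneg (fderiv ℝ (mollify n m) x e₁ + Complex.I * fderiv ℝ (mollify n m) x e₂)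
    linarith
  rw [commutator, norm_mul, h1, Complex.norm_real, Real.norm_of_nonneg h2, ← mul_add]
  exact mul_le_mul_of_nonneg_left h3 h2

/-- The commutator still tends to zero when multiplied by a power of the mollification: it is
bounded in `L^{4/3}` and tends to zero in the sense of distributions, while the power converges in
`L⁴`. The latter is replaced by its value at a fixed stage, which is smooth. -/
theorem IsEikonal.tendsto_pow_mul_commutator {U : Set Plane} (hU : IsOpen U) {m : Plane → ℂ}
    (hm : IsEikonal U m) {φ : Plane → ℂ} (hφ : IsTest U φ) (k : ℕ) :
    Tendsto (fun n => ∫ x, φ x * (mollify n m x ^ k * commutator n m x)) atTop (𝓝 0) := by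
  have hb : ∀ x, ‖m x‖ ≤ 1 := fun x => (hm.norm_eq_one x).le
  have hMc : ∀ n, Continuous (mollify n m) := fun n =>
    (contDiff_mollify hm.measurable hb n).continuous
  obtain ⟨U', r, η, hr, hKU', hU', hη, hη0, hη1, hηK⟩ :=
    exists_cutoff hU hφ.hasCompactSupport hφ.tsupport_subset
  obtain ⟨C, hC, hcomm⟩ := hm.exists_commutator_bound hU' hη hη0 hη1
  obtain ⟨A, hA⟩ := hφ.contDiff.continuous.bounded_above_of_compact_support hφ.hasCompactSupport
  have hA0 : 0 ≤ A := (norm_nonneg _).trans (hA 0)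
  have hφη : ∀ x, ‖φ x‖ ≤ A * η x ^ 4 := by
    intro x
    by_cases hx : x ∈ tsupport φ
    · rw [hηK x hx]; simpa using hA x
    · rw [image_eq_zero_of_notMem_tsupport hx, norm_zero]
      exact mul_nonneg hA0 (pow_nonneg (hη0 x) 4)
  have hηc : Continuous fun x => η x ^ 4 := hη.contDiff.continuous.pow 4
  have hηs : HasCompactSupport fun x => η x ^ 4 := by
    have : (fun x => η x ^ 4) = fun x => η x * η x ^ 3 := by funext x; ring
    rw [this]; exact hη.hasCompactSupport.mul_right
  set l : ℕ → ℝ := fun n => ∫ x, η x ^ 4 * ‖mollify n m x ^ k - m x ^ k‖ ^ 4 with hl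
  have hl0 : Tendsto l atTop (𝓝 0) := tendsto_integral_mollify_pow_sub hm.measurable hb hηc hηs k
  have hpow : ∀ n x, ‖mollify n m x ^ k‖ ≤ 1 := fun n x => by
    rw [norm_pow]; exact pow_le_one₀ (norm_nonneg _) (norm_mollify_le hb n x)
  have hlI : ∀ n, Integrable fun x => η x ^ 4 * ‖mollify n m x ^ k - m x ^ k‖ ^ 4 := by
    intro n
    refine integrable_mul_of_bounded (𝕜 := ℝ) (C := 2 ^ 4) hηc hηs
      ((((hMc n).measurable.pow_const k).sub
      (hm.measurable.pow_const k)).norm.pow_const 4).aestronglyMeasurable fun x => ?_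
    rw [norm_pow, norm_norm]
    refine pow_le_pow_left₀ (norm_nonneg _) ((norm_sub_le _ _).trans ?_) 4
    have h2 := pow_le_one₀ (n := k) (norm_nonneg _) (hb x)
    have h1 := hpow n x
    rw [norm_pow] at h1 ⊢
    rw [norm_pow]
    linarith
  set Q : ℝ := 2 * A * C + 1 with hQ
  have hQ0 : 0 < Q := by positivity
  have hdiff : ∀ n j : ℕ, ∀ κ : ℝ, 2 * scale n ^ 3 < r → 0 < κ →
      ‖(∫ x, φ x * (mollify n m x ^ k * commutator n m x))
        - ∫ x, (φ x * mollify j m x ^ k) * commutator n m x‖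
        ≤ Q * κ ^ 4 + Q * (8 * (κ⁻¹) ^ 12) * (l n + l j) := by
    intro n j κ hn hκ
    have hcc := continuous_commutator hm.measurable hb n
    set a : Plane → ℝ := fun x => ‖mollify n m x ^ k - mollify j m x ^ k‖ with ha
    have hac : Continuous a := (((hMc n).pow k).sub ((hMc j).pow k)).norm
    have ha2 : ∀ x, a x ≤ 2 := fun x => by
      refine (norm_sub_le _ _).trans ?_
      linarith [hpow n x, hpow j x]
    have h1 : Integrable fun x => φ x * (mollify n m x ^ k * commutator n m x) :=
      (hφ.contDiff.continuous.mul (((hMc n).pow k).mul hcc)).integrable_of_hasCompactSupport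
        hφ.hasCompactSupport.mul_right
    have h2 : Integrable fun x => (φ x * mollify j m x ^ k) * commutator n m x :=
      ((hφ.contDiff.continuous.mul ((hMc j).pow k)).mul hcc).integrable_of_hasCompactSupport
        hφ.hasCompactSupport.mul_right.mul_right
    rw [← integral_sub h1 h2]
    have hterm : ∀ v : Plane, Integrable fun x => A * (η x ^ 4 * (a x *
        ((1 - ‖mollify n m x‖ ^ 2) * ‖fderiv ℝ (mollify n m) x v‖))) := by
      intro v
      have hc : Continuous fun x => fderiv ℝ (mollify n m) x v :=
        ((contDiff_mollify hm.measurable hb n).continuous_fderiv (by norm_num)).clm_apply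
          continuous_const
      exact ((hηc.mul (hac.mul ((continuous_const.sub ((hMc n).norm.pow 2)).mul
        hc.norm))).integrable_of_hasCompactSupport hηs.mul_right).const_mul A
    have hB : ∀ v : Plane, ‖v‖ ≤ 1 → ∫ x, A * (η x ^ 4 * (a x *
        ((1 - ‖mollify n m x‖ ^ 2) * ‖fderiv ℝ (mollify n m) x v‖)))
        ≤ A * (C * (κ ^ 4 + (κ⁻¹) ^ 12 * (8 * (l n + l j)))) := by
      intro v hv
      rw [integral_const_mul]
      refine mul_le_mul_of_nonneg_left ((hcomm n κ 2 a v hn hκ hac.measurable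
        (fun x => norm_nonneg _) ha2 hv).trans ?_) hA0
      refine mul_le_mul_of_nonneg_left ?_ hC
      refine add_le_add le_rfl (mul_le_mul_of_nonneg_left ?_ (by positivity))
      rw [hl, ← integral_add (hlI n) (hlI j), ← integral_const_mul]
      refine integral_mono_of_nonneg (ae_of_all _ fun x => ?_)
        (((hlI n).add (hlI j)).const_mul 8) (ae_of_all _ fun x => ?_)
      · exact mul_nonneg (pow_nonneg (hη0 x) 4) (pow_nonneg (norm_nonneg _) 4)
      · have := mul_le_mul_of_nonneg_left (norm_sub_pow_four_le (mollify n m x ^ k)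
          (mollify j m x ^ k) (m x ^ k)) (pow_nonneg (hη0 x) 4)
        refine this.trans_eq ?_
        simp only
        ring
    calc ‖∫ x, (φ x * (mollify n m x ^ k * commutator n m x)
          - (φ x * mollify j m x ^ k) * commutator n m x)‖
        ≤ ∫ x, (A * (η x ^ 4 * (a x *
            ((1 - ‖mollify n m x‖ ^ 2) * ‖fderiv ℝ (mollify n m) x e₁‖)))
          + A * (η x ^ 4 * (a x *
            ((1 - ‖mollify n m x‖ ^ 2) * ‖fderiv ℝ (mollify n m) x e₂‖)))) := by
          refine norm_integral_le_of_norm_le ((hterm e₁).add (hterm e₂)) (ae_of_all _ fun x => ?_)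
          have e : φ x * (mollify n m x ^ k * commutator n m x)
              - (φ x * mollify j m x ^ k) * commutator n m x
              = φ x * ((mollify n m x ^ k - mollify j m x ^ k) * commutator n m x) := by ring
          rw [e, norm_mul, norm_mul]
          calc _ ≤ (A * η x ^ 4) * (a x * _) :=
                mul_le_mul (hφη x) (mul_le_mul_of_nonneg_left (norm_commutator_le hb n x)
                  (norm_nonneg _)) (by positivity) (mul_nonneg hA0 (pow_nonneg (hη0 x) 4))
            _ = _ := by ring
      _ ≤ A * (C * (κ ^ 4 + (κ⁻¹) ^ 12 * (8 * (l n + l j))))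
          + A * (C * (κ ^ 4 + (κ⁻¹) ^ 12 * (8 * (l n + l j)))) := by
          rw [integral_add (hterm e₁) (hterm e₂)]
          exact add_le_add (hB e₁ norm_e₁.le) (hB e₂ norm_e₂.le)
      _ = (2 * A * C) * (κ ^ 4 + (κ⁻¹) ^ 12 * (8 * (l n + l j))) := by ring
      _ ≤ Q * (κ ^ 4 + (κ⁻¹) ^ 12 * (8 * (l n + l j))) := by
          have hlnn : ∀ n, 0 ≤ l n := fun n =>
            integral_nonneg fun x =>
              mul_nonneg (pow_nonneg (hη0 x) 4) (pow_nonneg (norm_nonneg _) 4)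
          have := hlnn n
          have := hlnn j
          exact mul_le_mul_of_nonneg_right (by rw [hQ]; linarith) (by positivity)
      _ = _ := by ring
  have hsmall : ∀ᶠ n in atTop, 2 * scale n ^ 3 < r := by
    have : Tendsto (fun n => 2 * scale n ^ 3) atTop (𝓝 0) := by
      simpa using (tendsto_scale.pow 3).const_mul 2
    exact this.eventually_lt_const hr
  rw [Metric.tendsto_nhds]
  intro τ hτ
  -- the parameters are fixed in the order `κ`, then the frozen stage `j`, then `n`
  set κ : ℝ := min 1 (τ / (8 * Q)) with hκdef
  have hκ : 0 < κ := lt_min one_pos (by positivity)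
  have hκ4 : Q * κ ^ 4 ≤ τ / 8 := by
    have h1 : κ ^ 4 ≤ κ := pow_le_of_le_one hκ.le (min_le_left _ _) (by norm_num)
    calc Q * κ ^ 4 ≤ Q * (τ / (8 * Q)) :=
          mul_le_mul_of_nonneg_left (h1.trans (min_le_right _ _)) hQ0.le
      _ = τ / 8 := by field_simp
  have hlim : Tendsto (fun n => Q * (8 * (κ⁻¹) ^ 12) * l n) atTop (𝓝 0) := by
    have h := hl0.const_mul (Q * (8 * (κ⁻¹) ^ 12))
    rwa [mul_zero] at h
  have hev : ∀ᶠ n in atTop, Q * (8 * (κ⁻¹) ^ 12) * l n < τ / 4 :=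
    hlim.eventually_lt_const (by positivity)
  obtain ⟨j, hj⟩ := hev.exists
  have hT := hm.tendsto_commutator hU
    (hφ.mul ((contDiff_mollify hm.measurable hb j).pow k))
  rw [Metric.tendsto_nhds] at hT
  filter_upwards [hsmall, hev, hT (τ / 4) (by positivity)] with n h1 h2 h3
  rw [dist_zero_right] at h3 ⊢
  have h4 := hdiff n j κ h1 hκ
  have h5 := norm_le_norm_sub_add (∫ x, φ x * (mollify n m x ^ k * commutator n m x))
    (∫ x, (φ x * mollify j m x ^ k) * commutator n m x)
  rw [mul_add] at h4
  linarith

/-- The Fourier mode `k + 2` of the kinetic formulation: every trigonometric entropy is conserved.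
-/
theorem IsEikonal.integral_mode {U : Set Plane} (hU : IsOpen U) {m : Plane → ℂ}
    (hm : IsEikonal U m) {φ : Plane → ℂ} (hφ : IsTest U φ) (k : ℕ) :
    ∫ x, (dzbar φ x * ((k + 3) * m x ^ (k + 1)) + dz φ x * ((k + 1) * m x ^ (k + 3))) = 0 := by
  have h1 := (hm.tendsto_mode hφ k).congr' (hm.eventually_identity hU hφ k)
  have h2 := (hm.tendsto_pow_mul_commutator hU hφ k).const_mul
    (-(((k : ℂ) + 1) * (k + 2) * (k + 3)))
  rw [mul_zero] at h2
  exact tendsto_nhds_unique h1 h2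

/-! ### From trigonometric to discontinuous entropies -/

/-- The derivative of `ζ` at `x` in the direction `(Re a, Im a)`. -/
def along (a : ℂ) (ζ : Plane → ℝ) (x : Plane) : ℝ :=
  a.re * fderiv ℝ ζ x e₁ + a.im * fderiv ℝ ζ x e₂

theorem integrable_along {U : Set Plane} {V : Plane → ℂ} (hV : Measurable V)
    (hb : ∀ x, ‖V x‖ = 1) {ζ : Plane → ℝ} (hζ : IsTest U ζ) :
    Integrable fun x => along (V x) ζ x :=
  integrable_divFree_integrand hV (fun x => (hb x).le) hζ

theorem IsTest.ofReal {U : Set Plane} {ζ : Plane → ℝ} (hζ : IsTest U ζ) :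
    IsTest U fun x => (ζ x : ℂ) where
  contDiff := Complex.ofRealCLM.contDiff.comp hζ.contDiff
  hasCompactSupport := hζ.hasCompactSupport.comp_left (g := Complex.ofReal) rfl
  tsupport_subset := (closure_mono
    (Function.support_comp_subset (g := Complex.ofReal) rfl ζ)).trans hζ.tsupport_subset

theorem IsTest.fderiv_ofReal {U : Set Plane} {ζ : Plane → ℝ} (hζ : IsTest U ζ) (x v : Plane) :
    fderiv ℝ (fun x => (ζ x : ℂ)) x v = (fderiv ℝ ζ x v : ℂ) := by
  have h := (Complex.ofRealCLM.hasFDerivAt.comp x (hζ.differentiable x).hasFDerivAt).fderiv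
  change fderiv ℝ (Complex.ofRealCLM ∘ ζ) x v = _
  rw [h]; rfl

theorem IsEikonal.mul_conj {U : Set Plane} {m : Plane → ℂ} (hm : IsEikonal U m) (x : Plane) :
    m x * conj (m x) = 1 := by
  rw [Complex.mul_conj', hm.norm_eq_one]; simp

theorem IsEikonal.ne_zero {U : Set Plane} {m : Plane → ℂ} (hm : IsEikonal U m) (x : Plane) :
    m x ≠ 0 := by
  rw [← norm_ne_zero_iff, hm.norm_eq_one]; exact one_ne_zero

theorem IsEikonal.norm_I_mul {U : Set Plane} {m : Plane → ℂ} (hm : IsEikonal U m) (x : Plane) :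
    ‖Complex.I * m x‖ = 1 := by
  rw [norm_mul, Complex.norm_I, hm.norm_eq_one, one_mul]

theorem IsEikonal.measurable_I_mul {U : Set Plane} {m : Plane → ℂ} (hm : IsEikonal U m) :
    Measurable fun x => Complex.I * m x := measurable_const.mul hm.measurable

theorem along_add_I_mul_along (a : ℂ) (ζ : Plane → ℝ) (x : Plane) :
    (along a ζ x : ℂ) + Complex.I * (along (Complex.I * a) ζ x : ℂ)
      = conj a * (fderiv ℝ ζ x e₁ + Complex.I * fderiv ℝ ζ x e₂) := by
  apply Complex.ext
  · simp [along]
  · simp [along]; ring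

theorem along_sub_I_mul_along (a : ℂ) (ζ : Plane → ℝ) (x : Plane) :
    (along a ζ x : ℂ) - Complex.I * (along (Complex.I * a) ζ x : ℂ)
      = a * (fderiv ℝ ζ x e₁ - Complex.I * fderiv ℝ ζ x e₂) := by
  apply Complex.ext <;> simp [along]

theorem IsEikonal.integral_pow {U : Set Plane} (hU : IsOpen U) {m : Plane → ℂ}
    (hm : IsEikonal U m) {ζ : Plane → ℝ} (hζ : IsTest U ζ) (n : ℕ) :
    ∫ x, m x ^ n * (n * (along (m x) ζ x : ℂ)
      + Complex.I * (along (Complex.I * m x) ζ x : ℂ)) = 0 := by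
  rcases n with _ | _ | k
  · have h := hm.curl ζ hζ
    have h' : ∫ x, along (Complex.I * m x) ζ x = 0 := h
    have h'' : ∫ x, (along (Complex.I * m x) ζ x : ℂ) = 0 := by
      rw [integral_complex_ofReal, h', Complex.ofReal_zero]
    simp only [pow_zero, one_mul, Nat.cast_zero, zero_mul, zero_add]
    rw [integral_const_mul, h'', mul_zero]
  · have hpt : ∀ x, m x ^ (0 + 1) * (((0 + 1 : ℕ) : ℂ) * (along (m x) ζ x : ℂ)
        + Complex.I * (along (Complex.I * m x) ζ x : ℂ))
        = fderiv ℝ (fun x => (ζ x : ℂ)) x e₁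
          + Complex.I * fderiv ℝ (fun x => (ζ x : ℂ)) x e₂ := by
      intro x
      rw [hζ.fderiv_ofReal, hζ.fderiv_ofReal]
      have h1 := along_add_I_mul_along (m x) ζ x
      push_cast
      rw [pow_one, one_mul, h1, ← mul_assoc, hm.mul_conj, one_mul]
    simp only [hpt]
    have hI : ∀ v, Integrable fun x => fderiv ℝ (fun x => (ζ x : ℂ)) x v := fun v =>
      (hζ.ofReal.continuous_fderiv v).integrable_of_hasCompactSupport
        (hζ.ofReal.hasCompactSupport_fderiv v)
    rw [integral_add (hI e₁) ((hI e₂).const_mul _), integral_const_mul,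
      integral_fderiv_eq_zero hζ.ofReal, integral_fderiv_eq_zero hζ.ofReal]
    simp
  · rw [← hm.integral_mode hU hζ.ofReal k]
    congr 1
    funext x
    have h1 := along_add_I_mul_along (m x) ζ x
    have h2 := along_sub_I_mul_along (m x) ζ x
    have h3 := hm.mul_conj x
    simp only [dz, dzbar]
    rw [hζ.fderiv_ofReal, hζ.fderiv_ofReal]
    push_cast
    linear_combination (m x ^ (k + 2) * (k + 3) / 2) * h1 + (m x ^ (k + 2) * (k + 1) / 2) * h2
      + ((k + 3) / 2 * m x ^ (k + 1) *
        (fderiv ℝ ζ x e₁ + Complex.I * fderiv ℝ ζ x e₂)) * h3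

/-- All Fourier modes, in terms of derivatives along the orthonormal frame `m`, `i m`. The negative
modes are the complex conjugates of the positive ones. -/
theorem IsEikonal.integral_zpow {U : Set Plane} (hU : IsOpen U) {m : Plane → ℂ}
    (hm : IsEikonal U m) {ζ : Plane → ℝ} (hζ : IsTest U ζ) (n : ℤ) :
    ∫ x, m x ^ n * (n * (along (m x) ζ x : ℂ)
      + Complex.I * (along (Complex.I * m x) ζ x : ℂ)) = 0 := by
  obtain ⟨k, rfl | rfl⟩ := n.eq_nat_or_neg
  · simpa using hm.integral_pow hU hζ k
  · have h := congrArg conj (hm.integral_pow hU hζ k)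
    rw [← integral_conj, map_zero] at h
    rw [← neg_eq_zero, ← integral_neg, ← h]
    congr 1
    funext x
    have h1 : m x ^ (-(k : ℤ)) = conj (m x) ^ k := by
      rw [zpow_neg, zpow_natCast, ← inv_pow]
      congr 1
      rw [inv_eq_of_mul_eq_one_right (hm.mul_conj x)]
    rw [h1]
    simp
    ring

theorem measurable_zpow_comp {m : Plane → ℂ} (hm : Measurable m) (n : ℤ) :
    Measurable fun x => m x ^ n := by
  rcases n with k | k
  · simpa using hm.pow_const k
  · simp only [zpow_negSucc]
    exact (hm.pow_const (k + 1)).inv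

theorem integrable_mul_ofReal {f : Plane → ℂ} {g : Plane → ℝ} {C : ℝ} (hf : Measurable f)
    (hb : ∀ x, ‖f x‖ ≤ C) (hg : Integrable g) : Integrable fun x => f x * (g x : ℂ) :=
  hg.ofReal.bdd_mul (c := C) hf.aestronglyMeasurable (ae_of_all _ hb)

/-- The coordinate `w · ξ` of the rotated field `w = i m`, for `ξ = (Re c, Im c)`. -/
def rotCoord (c z : ℂ) : ℝ := (conj c * (Complex.I * z)).re

/-- The coordinate `m · ξ`, for `ξ = (Re c, Im c)`. -/
def coord (c z : ℂ) : ℝ := (conj c * z).re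

theorem continuous_rotCoord (c : ℂ) : Continuous (rotCoord c) := by unfold rotCoord; fun_prop

theorem continuous_coord (c : ℂ) : Continuous (coord c) := by unfold coord; fun_prop

theorem abs_rotCoord_le {c z : ℂ} (hc : ‖c‖ = 1) (hz : ‖z‖ = 1) : |rotCoord c z| ≤ 1 := by
  refine (Complex.abs_re_le_norm _).trans ?_
  simp [hc, hz]

theorem abs_coord_le_one {c z : ℂ} (hc : ‖c‖ = 1) (hz : ‖z‖ = 1) : |coord c z| ≤ 1 := by
  refine (Complex.abs_re_le_norm _).trans ?_
  simp [hc, hz]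

/-- The derivative along the circle of `s ^ N * z ^ n`, where `s = rotCoord c z` has derivative
`-coord c z`, tested against `m`, plus the function itself tested against `i m`. -/
def modeIntegrand (c : ℂ) (m : Plane → ℂ) (ζ : Plane → ℝ) (N : ℕ) (n : ℤ) (x : Plane) : ℂ :=
  -(-(N * (rotCoord c (m x) : ℂ) ^ (N - 1) * coord c (m x)) * m x ^ n
      + Complex.I * n * (rotCoord c (m x) : ℂ) ^ N * m x ^ n) * (along (m x) ζ x : ℂ)
    + (rotCoord c (m x) : ℂ) ^ N * m x ^ n * (along (Complex.I * m x) ζ x : ℂ)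

theorem IsEikonal.integrable_modeIntegrand {U : Set Plane} {m : Plane → ℂ}
    (hm : IsEikonal U m) {ζ : Plane → ℝ} (hζ : IsTest U ζ) {c : ℂ} (hc : ‖c‖ = 1) (N : ℕ) (n : ℤ) :
    Integrable (modeIntegrand c m ζ N n) := by
  have hs : Measurable fun x => (rotCoord c (m x) : ℂ) :=
    Complex.measurable_ofReal.comp ((continuous_rotCoord c).measurable.comp hm.measurable)
  have hq : Measurable fun x => (coord c (m x) : ℂ) :=
    Complex.measurable_ofReal.comp ((continuous_coord c).measurable.comp hm.measurable)
  have hz := measurable_zpow_comp hm.measurable n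
  have hsb : ∀ x (j : ℕ), ‖(rotCoord c (m x) : ℂ) ^ j‖ ≤ 1 := fun x j => by
    rw [norm_pow, Complex.norm_real]
    exact pow_le_one₀ (norm_nonneg _) (abs_rotCoord_le hc (hm.norm_eq_one x))
  have hqb : ∀ x, ‖(coord c (m x) : ℂ)‖ ≤ 1 := fun x => by
    rw [Complex.norm_real]; exact abs_coord_le_one hc (hm.norm_eq_one x)
  have hzb : ∀ x, ‖m x ^ n‖ = 1 := fun x => by rw [norm_zpow, hm.norm_eq_one, one_zpow]
  refine (integrable_mul_ofReal (C := N + |(n : ℝ)|) ?_ (fun x => ?_)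
    (integrable_along hm.measurable hm.norm_eq_one hζ)).add
    (integrable_mul_ofReal (C := 1) ?_ (fun x => ?_)
    (integrable_along hm.measurable_I_mul hm.norm_I_mul hζ))
  · exact ((((measurable_const.mul (hs.pow_const _)).mul hq).neg.mul hz).add
      ((measurable_const.mul (hs.pow_const _)).mul hz)).neg
  · rw [norm_neg]
    refine (norm_add_le _ _).trans (add_le_add ?_ ?_)
    · rw [norm_mul, hzb, mul_one, norm_neg, norm_mul, norm_mul, Complex.norm_natCast, mul_assoc]
      exact mul_le_of_le_one_right (Nat.cast_nonneg _)
        (mul_le_one₀ (hsb x _) (norm_nonneg _) (hqb x))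
    · rw [norm_mul, hzb, mul_one, norm_mul, norm_mul, Complex.norm_I, one_mul,
        Complex.norm_intCast]
      exact mul_le_of_le_one_right (abs_nonneg _) (hsb x N)
  · exact (hs.pow_const N).mul hz
  · rw [norm_mul, hzb, mul_one]; exact hsb x N

/-- On the unit circle `s = (i c̄ z - i c z⁻¹) / 2`, so that a further factor `s` combines two
neighbouring modes. -/
theorem IsEikonal.modeIntegrand_succ {U : Set Plane} {m : Plane → ℂ} (hm : IsEikonal U m)
    (ζ : Plane → ℝ) (c : ℂ) (N : ℕ) (n : ℤ) (x : Plane) :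
    modeIntegrand c m ζ (N + 1) n x = (Complex.I * conj c / 2) * modeIntegrand c m ζ N (n + 1) x
      + (-Complex.I * c / 2) * modeIntegrand c m ζ N (n - 1) x := by
  have hs : (rotCoord c (m x) : ℂ) = (Complex.I * conj c * m x - Complex.I * c * (m x)⁻¹) / 2 := by
    rw [inv_eq_of_mul_eq_one_right (hm.mul_conj x)]
    apply Complex.ext
    · simp [rotCoord]; ring
    · simp [rotCoord]
  have hq : (coord c (m x) : ℂ) = (conj c * m x + c * (m x)⁻¹) / 2 := by
    rw [inv_eq_of_mul_eq_one_right (hm.mul_conj x)]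
    apply Complex.ext
    · simp [coord]
    · simp [coord]; ring
  have hN : (N : ℂ) * (rotCoord c (m x) : ℂ) ^ (N - 1) * rotCoord c (m x)
      = N * (rotCoord c (m x) : ℂ) ^ N := by
    rcases N with _ | N
    · simp
    · rw [Nat.add_sub_cancel, pow_succ]; ring
  have hI : Complex.I ^ 2 = -1 := Complex.I_sq
  simp only [modeIntegrand, Nat.add_sub_cancel, zpow_add_one₀ (hm.ne_zero x),
    zpow_sub_one₀ (hm.ne_zero x)]
  generalize (rotCoord c (m x) : ℂ) = s at hs hN ⊢
  generalize (coord c (m x) : ℂ) = q at hq ⊢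
  generalize (m x)⁻¹ = y at hs hq ⊢
  generalize m x ^ n = z
  generalize (along (m x) ζ x : ℂ) = a
  generalize (along (Complex.I * m x) ζ x : ℂ) = b
  generalize m x = w at hs hq ⊢
  push_cast
  have e1 : (Complex.I * conj c * w - Complex.I * c * y) = 2 * s := by rw [hs]; ring
  have e2 : conj c * w + c * y = 2 * q := by rw [hq]; ring
  rw [pow_succ s N]
  linear_combination (-(a * q * z)) * hN
    - ((N * s ^ (N - 1) * q * z * a - Complex.I * n * s ^ N * z * a + s ^ N * z * b) / 2) * e1
    - (s ^ N * z * a / 2) * e2 + (s ^ N * z * a * (conj c * w + c * y) / 2) * hI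

theorem IsEikonal.integral_modeIntegrand {U : Set Plane} (hU : IsOpen U) {m : Plane → ℂ}
    (hm : IsEikonal U m) {ζ : Plane → ℝ} (hζ : IsTest U ζ) {c : ℂ} (hc : ‖c‖ = 1) (N : ℕ) :
    ∀ n : ℤ, ∫ x, modeIntegrand c m ζ N n x = 0 := by
  induction N with
  | zero =>
    intro n
    have h := hm.integral_zpow hU hζ n
    have hpt : ∀ x, modeIntegrand c m ζ 0 n x = -Complex.I * (m x ^ n * (n * (along (m x) ζ x : ℂ)
      + Complex.I * (along (Complex.I * m x) ζ x : ℂ))) := by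
      intro x
      simp only [modeIntegrand]
      push_cast
      linear_combination (m x ^ n * (along (Complex.I * m x) ζ x : ℂ)) * Complex.I_sq
    simp only [hpt]
    rw [integral_const_mul, h, mul_zero]
  | succ N ih =>
    intro n
    simp only [hm.modeIntegrand_succ]
    rw [integral_add ((hm.integrable_modeIntegrand hζ hc N _).const_mul _)
      ((hm.integrable_modeIntegrand hζ hc N _).const_mul _), integral_const_mul,
      integral_const_mul, ih, ih]
    simp

/-- The entropy with profile `∫₀ˢ g`, tested against `∇ζ`. Here `s = w · ξ` with `w = i m`
and `ξ = (Re c, Im c)`. -/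
def profileIntegrand (c : ℂ) (m : Plane → ℂ) (ζ : Plane → ℝ) (g : ℝ → ℝ) (x : Plane) : ℝ :=
  g (rotCoord c (m x)) * coord c (m x) * along (m x) ζ x
    + (∫ t in (0 : ℝ)..rotCoord c (m x), g t) * along (Complex.I * m x) ζ x

theorem abs_integral_zero_le {g : ℝ → ℝ} {C s : ℝ} (hs : |s| ≤ 1)
    (hC : ∀ t ∈ Icc (-1 : ℝ) 1, |g t| ≤ C) : |∫ t in (0 : ℝ)..s, g t| ≤ C := by
  have hC0 : 0 ≤ C := (abs_nonneg _).trans (hC 0 (by norm_num))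
  have hs' := abs_le.1 hs
  have h := intervalIntegral.norm_integral_le_of_norm_le_const (a := 0) (b := s) (f := g) (C := C)
    (fun t ht => hC t (by
      have ht' := uIoc_subset_uIcc ht
      rw [mem_uIcc] at ht'
      constructor <;> rcases ht' with h | h <;> linarith [h.1, h.2]))
  rw [Real.norm_eq_abs, sub_zero] at h
  exact h.trans (mul_le_of_le_one_right hC0 hs)

section Profile

variable {U : Set Plane} {m : Plane → ℂ} {ζ : Plane → ℝ} {c : ℂ}

theorem IsEikonal.abs_profileIntegrand_le (hm : IsEikonal U m) (hc : ‖c‖ = 1) {g : ℝ → ℝ} {C : ℝ}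
    (hC : ∀ t ∈ Icc (-1 : ℝ) 1, |g t| ≤ C) (x : Plane) :
    |profileIntegrand c m ζ g x| ≤ C * (|along (m x) ζ x| + |along (Complex.I * m x) ζ x|) := by
  have hs := abs_rotCoord_le hc (hm.norm_eq_one x)
  have hq := abs_coord_le_one hc (hm.norm_eq_one x)
  have hC0 : 0 ≤ C := (abs_nonneg _).trans (hC 0 (by norm_num))
  refine (abs_add_le _ _).trans ?_
  rw [mul_add, abs_mul, abs_mul, abs_mul]
  refine add_le_add (mul_le_mul_of_nonneg_right ?_ (abs_nonneg _))
    (mul_le_mul_of_nonneg_right (abs_integral_zero_le hs hC) (abs_nonneg _))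
  calc |g (rotCoord c (m x))| * |coord c (m x)| ≤ C * 1 :=
        mul_le_mul (hC _ (abs_le.1 hs)) hq (abs_nonneg _) hC0
    _ = C := mul_one C

theorem IsEikonal.integrable_abs_along (hm : IsEikonal U m) (hζ : IsTest U ζ) :
    Integrable fun x => |along (m x) ζ x| + |along (Complex.I * m x) ζ x| :=
  (integrable_along hm.measurable hm.norm_eq_one hζ).abs.add
    (integrable_along hm.measurable_I_mul hm.norm_I_mul hζ).abs

theorem IsEikonal.aestronglyMeasurable_profileIntegrand (hm : IsEikonal U m) (hζ : IsTest U ζ)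
    {g : ℝ → ℝ} (hg : Continuous g) : AEStronglyMeasurable (profileIntegrand c m ζ g) := by
  have hs : Measurable fun x => rotCoord c (m x) :=
    (continuous_rotCoord c).measurable.comp hm.measurable
  have hq : Measurable fun x => coord c (m x) :=
    (continuous_coord c).measurable.comp hm.measurable
  have hprim : Continuous fun s : ℝ => ∫ t in (0 : ℝ)..s, g t :=
    intervalIntegral.continuous_primitive (fun a b => hg.intervalIntegrable a b) 0
  exact (((hg.measurable.comp hs).mul hq).aestronglyMeasurable.mul
      (integrable_along hm.measurable hm.norm_eq_one hζ).aestronglyMeasurable).add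
    ((hprim.measurable.comp hs).aestronglyMeasurable.mul
      (integrable_along hm.measurable_I_mul hm.norm_I_mul hζ).aestronglyMeasurable)

theorem IsEikonal.integrable_profileIntegrand (hm : IsEikonal U m) (hζ : IsTest U ζ)
    (hc : ‖c‖ = 1) {g : ℝ → ℝ} (hg : Continuous g) : Integrable (profileIntegrand c m ζ g) := by
  obtain ⟨C, hC⟩ := (isCompact_Icc (a := (-1 : ℝ)) (b := 1)).exists_bound_of_continuousOn
    hg.continuousOn
  exact ((hm.integrable_abs_along hζ).const_mul C).mono'
    (hm.aestronglyMeasurable_profileIntegrand hζ hg)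
    (ae_of_all _ fun x => hm.abs_profileIntegrand_le hc hC x)

theorem profileIntegrand_add {g₁ g₂ : ℝ → ℝ} (h₁ : Continuous g₁) (h₂ : Continuous g₂)
    (x : Plane) : profileIntegrand c m ζ (fun t => g₁ t + g₂ t) x
      = profileIntegrand c m ζ g₁ x + profileIntegrand c m ζ g₂ x := by
  simp only [profileIntegrand]
  rw [intervalIntegral.integral_add (h₁.intervalIntegrable _ _) (h₂.intervalIntegrable _ _)]
  ring

/-- The profile `∫₀ˢ t ^ N = s ^ (N + 1) / (N + 1)` is a multiple of the mode integrand with factor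
`s ^ (N + 1)` and frequency zero. -/
theorem IsEikonal.integral_profile_monomial (hU : IsOpen U) (hm : IsEikonal U m)
    (hζ : IsTest U ζ) (hc : ‖c‖ = 1) (N : ℕ) (a : ℝ) :
    ∫ x, profileIntegrand c m ζ (fun t => a * t ^ N) x = 0 := by
  have h := hm.integral_modeIntegrand hU hζ hc (N + 1) 0
  have hpt : ∀ x, ((profileIntegrand c m ζ (fun t => a * t ^ N) x : ℝ) : ℂ)
      = ((a : ℂ) / (N + 1)) * modeIntegrand c m ζ (N + 1) 0 x := by
    intro x
    have hN : ((N : ℂ) + 1) ≠ 0 := Nat.cast_add_one_ne_zero N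
    simp only [profileIntegrand, modeIntegrand, intervalIntegral.integral_const_mul,
      _root_.integral_pow]
    push_cast
    simp only [zpow_zero, zero_pow (Nat.succ_ne_zero N)]
    field_simp
    ring
  have h2 : ((∫ x, profileIntegrand c m ζ (fun t => a * t ^ N) x : ℝ) : ℂ) = 0 := by
    rw [← integral_complex_ofReal]
    simp only [hpt]
    rw [integral_const_mul, h, mul_zero]
  exact_mod_cast h2

theorem IsEikonal.integral_profile_polynomial (hU : IsOpen U) (hm : IsEikonal U m)
    (hζ : IsTest U ζ) (hc : ‖c‖ = 1) (p : Polynomial ℝ) :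
    ∫ x, profileIntegrand c m ζ (fun t => p.eval t) x = 0 := by
  induction p using Polynomial.induction_on' with
  | add p q hp hq =>
    simp only [Polynomial.eval_add, profileIntegrand_add p.continuous q.continuous]
    rw [integral_add (hm.integrable_profileIntegrand hζ hc p.continuous)
      (hm.integrable_profileIntegrand hζ hc q.continuous), hp, hq, add_zero]
  | monomial N a =>
    simp only [Polynomial.eval_monomial]
    exact hm.integral_profile_monomial hU hζ hc N a

/-- Weierstrass approximation of the profile. -/
theorem IsEikonal.integral_profile (hU : IsOpen U) (hm : IsEikonal U m) (hζ : IsTest U ζ)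
    (hc : ‖c‖ = 1) {g : ℝ → ℝ} (hg : Continuous g) : ∫ x, profileIntegrand c m ζ g x = 0 := by
  set S : ℝ := ∫ x, (|along (m x) ζ x| + |along (Complex.I * m x) ζ x|) with hS
  have hS0 : 0 ≤ S := integral_nonneg fun x => by positivity
  refine abs_eq_zero.1 (le_antisymm (le_of_forall_pos_le_add fun τ hτ => ?_) (abs_nonneg _))
  obtain ⟨p, hp⟩ := exists_polynomial_near_of_continuousOn (-1) 1 g hg.continuousOn
    (τ / (S + 1)) (by positivity)
  have hdiff : Continuous fun t => g t - p.eval t := hg.sub p.continuous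
  have hsplit : ∀ x, profileIntegrand c m ζ g x = profileIntegrand c m ζ (fun t => p.eval t) x
      + profileIntegrand c m ζ (fun t => g t - p.eval t) x := by
    intro x
    rw [← profileIntegrand_add p.continuous hdiff]
    simp
  simp only [hsplit]
  rw [integral_add (hm.integrable_profileIntegrand hζ hc p.continuous)
    (hm.integrable_profileIntegrand hζ hc hdiff), hm.integral_profile_polynomial hU hζ hc,
    zero_add, zero_add, ← Real.norm_eq_abs]
  refine (norm_integral_le_of_norm_le ((hm.integrable_abs_along hζ).const_mul (τ / (S + 1)))
    (ae_of_all _ fun x => hm.abs_profileIntegrand_le hc (fun t ht => ?_) x)).trans ?_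
  · rw [abs_sub_comm]; exact (hp t ht).le
  · rw [integral_const_mul, ← hS]
    calc τ / (S + 1) * S ≤ τ / (S + 1) * (S + 1) :=
          mul_le_mul_of_nonneg_left (by linarith) (by positivity)
      _ = τ := by field_simp

/-- Continuous approximations, vanishing for `t ≤ 0`, of the indicator function of `t > 0`. -/
def ramp (j : ℕ) (t : ℝ) : ℝ := min 1 (max 0 (((j : ℝ) + 1) * t))

theorem continuous_ramp (j : ℕ) : Continuous (ramp j) := by unfold ramp; fun_prop

theorem ramp_of_nonpos (j : ℕ) {t : ℝ} (ht : t ≤ 0) : ramp j t = 0 := by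
  have : ((j : ℝ) + 1) * t ≤ 0 := mul_nonpos_of_nonneg_of_nonpos (by positivity) ht
  rw [ramp, max_eq_left this, min_eq_right zero_le_one]

theorem abs_ramp_le (j : ℕ) (t : ℝ) : |ramp j t| ≤ 1 := by
  rw [ramp, abs_of_nonneg (le_min zero_le_one (le_max_left _ _))]
  exact min_le_left _ _

theorem tendsto_ramp_of_pos {t : ℝ} (ht : 0 < t) :
    Tendsto (fun j => ramp j t) atTop (𝓝 1) := by
  refine tendsto_const_nhds.congr' ?_
  obtain ⟨N, hN⟩ := exists_nat_gt (1 / t)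
  filter_upwards [eventually_ge_atTop N] with j hj
  have h1 : (N : ℝ) ≤ j := by exact_mod_cast hj
  have h2 : 1 ≤ ((j : ℝ) + 1) * t := by
    rw [div_lt_iff₀ ht] at hN
    nlinarith
  rw [ramp, min_eq_left (h2.trans (le_max_right _ _))]

theorem tendsto_integral_ramp_of_pos {s : ℝ} (hs : 0 < s) :
    Tendsto (fun j => ∫ t in (0 : ℝ)..s, ramp j t) atTop (𝓝 s) := by
  have h := intervalIntegral.tendsto_integral_filter_of_dominated_convergence
    (μ := volume) (a := 0) (b := s) (F := ramp) (f := fun _ => 1) (l := atTop) (fun _ => 1)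
    (Eventually.of_forall fun j => (continuous_ramp j).aestronglyMeasurable)
    (Eventually.of_forall fun j => ae_of_all _ fun t _ => abs_ramp_le j t)
    intervalIntegrable_const (ae_of_all _ fun t ht => by
      rw [uIoc_of_le hs.le] at ht
      exact tendsto_ramp_of_pos ht.1)
  simpa using h

theorem integral_ramp_of_nonpos (j : ℕ) {s : ℝ} (hs : s ≤ 0) :
    ∫ t in (0 : ℝ)..s, ramp j t = 0 := by
  rw [intervalIntegral.integral_congr (g := fun _ => 0), intervalIntegral.integral_zero]
  intro t ht
  rw [uIcc_of_ge hs] at ht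
  exact ramp_of_nonpos j ht.2

/-- Expansion of the direction `c` in the orthonormal frame `m`, `i m`. -/
theorem coord_mul_along_add (hz : ∀ x, ‖m x‖ = 1) (x : Plane) :
    coord c (m x) * along (m x) ζ x + rotCoord c (m x) * along (Complex.I * m x) ζ x
      = along c ζ x := by
  have h : (m x).re * (m x).re + (m x).im * (m x).im = 1 := by
    rw [← Complex.normSq_apply, ← Complex.sq_norm, hz, one_pow]
  simp [coord, rotCoord, along]
  linear_combination (c.re * fderiv ℝ ζ x e₁ + c.im * fderiv ℝ ζ x e₂) * h

/-- The kinetic equation: the half-plane indicator of `w = i m` in the direction `c` is constant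
along `c`. -/
theorem IsEikonal.integral_indicator_along (hU : IsOpen U) (hm : IsEikonal U m)
    (hζ : IsTest U ζ) (hc : ‖c‖ = 1) :
    ∫ x, (if 0 < rotCoord c (m x) then 1 else 0) * along c ζ x = 0 := by
  have hlim : Tendsto (fun j => ∫ x, profileIntegrand c m ζ (ramp j) x) atTop
      (𝓝 (∫ x, (if 0 < rotCoord c (m x) then 1 else 0) * along c ζ x)) := by
    refine tendsto_integral_of_dominated_convergence
      (fun x => 1 * (|along (m x) ζ x| + |along (Complex.I * m x) ζ x|))
      (fun j => hm.aestronglyMeasurable_profileIntegrand hζ (continuous_ramp j))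
      ((hm.integrable_abs_along hζ).const_mul 1)
      (fun j => ae_of_all _ fun x =>
        hm.abs_profileIntegrand_le hc (fun t _ => abs_ramp_le j t) x)
      (ae_of_all _ fun x => ?_)
    rw [← coord_mul_along_add hm.norm_eq_one x]
    simp only [profileIntegrand]
    by_cases hs : 0 < rotCoord c (m x)
    · rw [if_pos hs, one_mul]
      have h1 := ((tendsto_ramp_of_pos hs).mul_const (coord c (m x))).mul_const (along (m x) ζ x)
      have h2 := (tendsto_integral_ramp_of_pos hs).mul_const (along (Complex.I * m x) ζ x)
      simpa using h1.add h2
    · rw [if_neg hs, zero_mul]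
      have hs' := not_lt.1 hs
      simp only [ramp_of_nonpos _ hs', integral_ramp_of_nonpos _ hs', zero_mul, add_zero]
      exact tendsto_const_nhds
  simp only [hm.integral_profile hU hζ hc (continuous_ramp _)] at hlim
  exact tendsto_nhds_unique hlim tendsto_const_nhds

end Profile

/-! ### From the class `E` to the complex formulation -/

/-- The identification of the plane with `ℂ`. -/
def toComplex (z : Plane) : ℂ := ⟨z 0, z 1⟩

theorem measurable_toComplex : Measurable toComplex := by
  have : Continuous toComplex := by
    have h : toComplex = fun z : Plane => (z 0 : ℂ) + (z 1 : ℂ) * Complex.I := by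
      funext z; exact Complex.mk_eq_add_mul_I _ _
    rw [h]; fun_prop
  exact this.measurable

theorem norm_toComplex (z : Plane) : ‖toComplex z‖ = ‖z‖ := by
  rw [EuclideanSpace.norm_eq, Complex.norm_def, Complex.normSq_apply, Fin.sum_univ_two]
  simp [toComplex, sq]

theorem inner_plane (x y : Plane) : ⟪x, y⟫ = x 0 * y 0 + x 1 * y 1 := by
  simp [PiLp.inner_apply, Fin.sum_univ_two, mul_comm]

/-- A test function in `Ω`, bundled. -/
def IsTest.toTestFunction {Ω : TopologicalSpace.Opens Plane} {ζ : Plane → ℝ}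
    (hζ : IsTest (Ω : Set Plane) ζ) : 𝓓(Ω, ℝ) :=
  ⟨ζ, hζ.contDiff, hζ.hasCompactSupport, hζ.tsupport_subset⟩

theorem isTest_testFunction {Ω : TopologicalSpace.Opens Plane} (ζ : 𝓓(Ω, ℝ)) :
    IsTest (Ω : Set Plane) ζ :=
  ⟨ζ.contDiff, ζ.hasCompactSupport, ζ.tsupport_subset⟩

theorem IsTest.fderiv_eq_zero {F : Type*} [NormedAddCommGroup F] [NormedSpace ℝ F] {U : Set Plane}
    {ζ : Plane → F} (hζ : IsTest U ζ) {x : Plane} (hx : x ∉ U) : fderiv ℝ ζ x = 0 :=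
  image_eq_zero_of_notMem_tsupport fun h =>
    hx (hζ.tsupport_subset (tsupport_fderiv_subset ℝ h))

theorem IsTest.eq_zero {F : Type*} [NormedAddCommGroup F] [NormedSpace ℝ F] {U : Set Plane}
    {ζ : Plane → F} (hζ : IsTest U ζ) {x : Plane} (hx : x ∉ U) : ζ x = 0 :=
  image_eq_zero_of_notMem_tsupport fun h => hx (hζ.tsupport_subset h)

theorem integrable_smul_of_locallyIntegrableOn {U : Set Plane} {f : Plane → Plane}
    (hf : LocallyIntegrableOn f U) {ζ : Plane → ℝ} (hζ : IsTest U ζ) :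
    Integrable fun x => ζ x • f x := by
  have hK : IntegrableOn f (tsupport ζ) :=
    hf.integrableOn_compact_subset hζ.tsupport_subset hζ.hasCompactSupport
  obtain ⟨C, hC⟩ := hζ.contDiff.continuous.bounded_above_of_compact_support hζ.hasCompactSupport
  have h1 : IntegrableOn (fun x => ζ x • f x) (tsupport ζ) :=
    Integrable.bdd_smul hK C hζ.contDiff.continuous.aestronglyMeasurable (ae_of_all _ hC)
  refine (integrableOn_iff_integrable_of_support_subset fun x hx => ?_).1 h1
  exact subset_tsupport _ fun h => hx (by simp [h])

/-- Two weak gradients of the same function agree almost everywhere. The gradient given in the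
theorem may therefore be replaced by the one from the definition of `E`. -/
theorem IsWeakGradient.ae_eq {Ω : TopologicalSpace.Opens Plane} {u : Plane → ℝ}
    {g g' : Plane → Plane} (hg : IsWeakGradient Ω u g) (hg' : IsWeakGradient Ω u g') :
    ∀ᵐ x, x ∈ (Ω : Set Plane) → g x = g' x := by
  have h := Ω.isOpen.ae_eq_zero_of_integral_contDiff_smul_eq_zero (μ := volume)
    (hg.2.1.sub hg'.2.1) fun ζ h1 h2 h3 => ?_
  · filter_upwards [h] with x hx hxΩ
    exact sub_eq_zero.1 (hx hxΩ)
  · have hζ : IsTest (Ω : Set Plane) ζ := ⟨h1, h2, h3⟩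
    have hI := integrable_smul_of_locallyIntegrableOn (hg.2.1.sub hg'.2.1) hζ
    refine integral_eq_zero_of_forall_integral_inner_eq_zero ℝ _ hI fun v => ?_
    have hpart : ∀ {g : Plane → Plane}, IsWeakGradient Ω u g →
        Integrable (fun x => ⟪g x, v⟫ * ζ x) ∧
        ∫ x, ⟪g x, v⟫ * ζ x = - ∫ x in (Ω : Set Plane), u x * fderiv ℝ ζ x v := by
      intro g hg
      have hi : Integrable fun x => ⟪g x, v⟫ * ζ x := by
        refine ((integrable_smul_of_locallyIntegrableOn hg.2.1 hζ).inner_const v).congr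
          (ae_of_all _ fun x => ?_)
        simp only [real_inner_smul_left]
        ring
      refine ⟨hi, ?_⟩
      have h4 := hg.2.2 hζ.toTestFunction v
      have h5 : ∫ x in (Ω : Set Plane), u x * fderiv ℝ ζ x v
          = -∫ x in (Ω : Set Plane), ⟪g x, v⟫ * ζ x := h4
      rw [h5, neg_neg, setIntegral_eq_integral_of_forall_compl_eq_zero]
      intro x hx
      rw [hζ.eq_zero hx, mul_zero]
    have h6 := integral_sub (hpart hg).1 (hpart hg').1
    rw [(hpart hg).2, (hpart hg').2, sub_self] at h6
    rw [← h6]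
    congr 1
    funext x
    rw [real_inner_comm, Pi.sub_apply, real_inner_smul_left, inner_sub_left]
    ring

theorem setIntegral_eq_integral_of_ae {Ω : Set Plane} (hΩ : MeasurableSet Ω) {f g : Plane → ℝ}
    (h : ∀ᵐ x, x ∈ Ω → f x = g x) (h0 : ∀ x, x ∉ Ω → g x = 0) :
    ∫ x in Ω, f x = ∫ x, g x := by
  rw [setIntegral_congr_ae hΩ h, setIntegral_eq_integral_of_forall_compl_eq_zero h0]

theorem fderiv_apply_eq_along (ζ : Plane → ℝ) (x v : Plane) :
    fderiv ℝ ζ x v = along (toComplex v) ζ x := by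
  conv_lhs => rw [plane_eq v]
  simp [along, toComplex]

theorem along_smul (t : ℝ) (a : ℂ) (ζ : Plane → ℝ) (x : Plane) :
    along ((t : ℂ) * a) ζ x = t * along a ζ x := by
  simp [along]; ring

theorem IsTest.along_eq_zero {U : Set Plane} {ζ : Plane → ℝ} (hζ : IsTest U ζ) {x : Plane}
    (hx : x ∉ U) (a : ℂ) : along a ζ x = 0 := by
  simp [along, hζ.fderiv_eq_zero hx]

/-- On the unit circle, `Σ_{e₁e₂}` is a sixth of `3 z̄ + z³`. -/
theorem toComplex_entropySigma_e {p : Plane} (hp : ‖p‖ = 1) :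
    toComplex (entropySigma e₁ e₂ p)
      = ((1 / 6 : ℝ) : ℂ) * (3 * conj (toComplex p) + toComplex p ^ 3) := by
  have h : p 0 ^ 2 + p 1 ^ 2 = 1 := by
    have := EuclideanSpace.real_norm_sq_eq p
    rw [hp, Fin.sum_univ_two] at this
    linarith
  have h3 : toComplex p ^ 3 = ⟨p 0 ^ 3 - 3 * p 0 * p 1 ^ 2, 3 * p 0 ^ 2 * p 1 - p 1 ^ 3⟩ := by
    apply Complex.ext <;> simp [toComplex, pow_succ] <;> ring
  rw [h3]
  apply Complex.ext
  · rw [Complex.re_ofReal_mul]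
    simp [entropySigma, inner_plane, toComplex, e₁, e₂]
    linear_combination (-(1 / 2) * p 0) * h
  · rw [Complex.im_ofReal_mul]
    simp [entropySigma, inner_plane, toComplex, e₁, e₂]
    linear_combination ((1 / 2) * p 1) * h

/-- On the unit circle, `Σ_{ε₁ε₂}` is a sixth of `i (3 z̄ - z³)`. -/
theorem toComplex_entropySigma_ε {p : Plane} (hp : ‖p‖ = 1) :
    toComplex (entropySigma ε₁ ε₂ p)
      = ((1 / 6 : ℝ) : ℂ) * (Complex.I * (3 * conj (toComplex p) - toComplex p ^ 3)) := by
  have h : p 0 ^ 2 + p 1 ^ 2 = 1 := by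
    have := EuclideanSpace.real_norm_sq_eq p
    rw [hp, Fin.sum_univ_two] at this
    linarith
  have h3 : toComplex p ^ 3 = ⟨p 0 ^ 3 - 3 * p 0 * p 1 ^ 2, 3 * p 0 ^ 2 * p 1 - p 1 ^ 3⟩ := by
    apply Complex.ext <;> simp [toComplex, pow_succ] <;> ring
  have ht : (1 / Real.sqrt 2) ^ 2 = 1 / 2 := by
    rw [div_pow, Real.sq_sqrt (by norm_num)]; norm_num
  rw [h3]
  generalize ht' : 1 / Real.sqrt 2 = t at ht
  apply Complex.ext
  · rw [Complex.re_ofReal_mul]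
    simp only [entropySigma, inner_plane, toComplex, ε₁, ε₂, ht']
    simp
    linear_combination (2 * p 1 - 8 / 3 * p 1 ^ 3 * (t ^ 2 + 1 / 2)) * ht - (p 1 / 2) * h
  · rw [Complex.im_ofReal_mul]
    simp only [entropySigma, inner_plane, toComplex, ε₁, ε₂, ht']
    simp
    linear_combination (2 * p 0 - 8 / 3 * p 0 ^ 3 * (t ^ 2 + 1 / 2)) * ht - (p 0 / 2) * h

/-- A weak gradient is curl free, by symmetry of the second derivatives of test functions. -/
theorem IsWeakGradient.curl {Ω : TopologicalSpace.Opens Plane} {u : Plane → ℝ}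
    {g : Plane → Plane} (hg : IsWeakGradient Ω u g) {ζ : Plane → ℝ}
    (hζ : IsTest (Ω : Set Plane) ζ) :
    ∫ x in (Ω : Set Plane), g x 0 * fderiv ℝ ζ x e₂
      = ∫ x in (Ω : Set Plane), g x 1 * fderiv ℝ ζ x e₁ := by
  have h1 := hg.2.2 (hζ.fderiv_apply e₂).toTestFunction e₁
  have h2 := hg.2.2 (hζ.fderiv_apply e₁).toTestFunction e₂
  have h1' : ∫ x in (Ω : Set Plane), u x * fderiv ℝ (fun x => fderiv ℝ ζ x e₂) x e₁
      = -∫ x in (Ω : Set Plane), ⟪g x, e₁⟫ * fderiv ℝ ζ x e₂ := h1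
  have h2' : ∫ x in (Ω : Set Plane), u x * fderiv ℝ (fun x => fderiv ℝ ζ x e₁) x e₂
      = -∫ x in (Ω : Set Plane), ⟪g x, e₂⟫ * fderiv ℝ ζ x e₁ := h2
  have hsymm : ∀ x, fderiv ℝ (fun x => fderiv ℝ ζ x e₂) x e₁
      = fderiv ℝ (fun x => fderiv ℝ ζ x e₁) x e₂ := by
    intro x
    have hd : DifferentiableAt ℝ (fderiv ℝ ζ) x :=
      ((hζ.contDiff.fderiv_right (m := ∞) (by norm_cast)).differentiable
        (by norm_num)).differentiableAt
    have hs : IsSymmSndFDerivAt ℝ ζ x :=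
      hζ.contDiff.contDiffAt.isSymmSndFDerivAt (by simp; norm_cast)
    rw [fderiv_clm_apply hd (differentiableAt_const _),
      fderiv_clm_apply hd (differentiableAt_const _)]
    simpa using hs e₁ e₂
  simp only [hsymm] at h1'
  rw [h1', neg_inj] at h2'
  simpa [inner_plane, e₁, e₂] using h2'

/-- The gradient of an element of `E` agrees almost everywhere in `Ω` with a complex field
satisfying the hypotheses of the analysis above; off `Ω` the field is set to `1`. -/
theorem exists_isEikonal {Ω : TopologicalSpace.Opens Plane} {u : Plane → ℝ} (hu : u ∈ E Ω)
    {g : Plane → Plane} (hg : IsWeakGradient Ω u g) :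
    ∃ m : Plane → ℂ, IsEikonal (Ω : Set Plane) m ∧
      ∀ᵐ x, x ∈ (Ω : Set Plane) → m x = toComplex (g x) := by
  obtain ⟨-, g', hg', hmem, hone, hdiv, hdiv'⟩ := hu
  have hΩm : MeasurableSet (Ω : Set Plane) := Ω.isOpen.measurableSet
  have hgm := hmem.1
  set G := hgm.mk g' with hG
  have hGm : Measurable G := hgm.stronglyMeasurable_mk.measurable
  have hGe : ∀ᵐ x, x ∈ (Ω : Set Plane) → g' x = G x :=
    (ae_restrict_iff' hΩm).1 hgm.ae_eq_mk
  have hone' := (ae_restrict_iff' hΩm).1 hone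
  classical
  set m : Plane → ℂ := fun x => if x ∈ (Ω : Set Plane) ∧ ‖G x‖ = 1 then toComplex (G x) else 1
    with hm
  have hmm : Measurable m := by
    refine Measurable.ite ?_ (measurable_toComplex.comp hGm) measurable_const
    exact hΩm.inter (hGm.norm (measurableSet_singleton (1 : ℝ)))
  have hm1 : ∀ x, ‖m x‖ = 1 := by
    intro x
    simp only [hm]
    split_ifs with h
    · rw [norm_toComplex, h.2]
    · exact norm_one
  have hmg' : ∀ᵐ x, x ∈ (Ω : Set Plane) → m x = toComplex (g' x) ∧ ‖g' x‖ = 1 := by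
    filter_upwards [hGe, hone'] with x h1 h2 hx
    refine ⟨?_, h2 hx⟩
    simp only [hm]
    rw [if_pos ⟨hx, by rw [← h1 hx]; exact h2 hx⟩, h1 hx]
  refine ⟨m, ⟨hmm, hm1, fun ζ hζ => ?_, fun ζ hζ => ?_, fun ζ hζ => ?_⟩, ?_⟩
  · have h := hg'.curl hζ
    have hae : ∀ (i : Fin 2) (F : Plane → ℝ), (∀ x, x ∉ (Ω : Set Plane) → F x = 0) →
        ∫ x in (Ω : Set Plane), g' x i * F x
          = ∫ x, (if i = 0 then (m x).re else (m x).im) * F x := by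
      intro i F hF
      refine setIntegral_eq_integral_of_ae hΩm ?_ fun x hx => by rw [hF x hx, mul_zero]
      filter_upwards [hmg'] with x hx hxΩ
      rw [(hx hxΩ).1]
      fin_cases i <;> simp [toComplex]
    rw [hae 0 _ fun x hx => by rw [hζ.fderiv_eq_zero hx]; rfl,
      hae 1 _ fun x hx => by rw [hζ.fderiv_eq_zero hx]; rfl] at h
    simp only [if_true, one_ne_zero, if_false] at h
    have hre : Integrable fun x => (m x).re * fderiv ℝ ζ x e₂ :=
      integrable_mul_of_bounded' (C := 1) (hζ.continuous_fderiv _) (hζ.hasCompactSupport_fderiv _)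
        (Complex.measurable_re.comp hmm).aestronglyMeasurable
        fun x => (Complex.abs_re_le_norm _).trans (hm1 x).le
    have him : Integrable fun x => (m x).im * fderiv ℝ ζ x e₁ :=
      integrable_mul_of_bounded' (C := 1) (hζ.continuous_fderiv _) (hζ.hasCompactSupport_fderiv _)
        (Complex.measurable_im.comp hmm).aestronglyMeasurable
        fun x => (Complex.abs_im_le_norm _).trans (hm1 x).le
    have h' := integral_sub hre him
    rw [h, sub_self] at h'
    rw [← h']
    congr 1
    funext x
    simp
    ring
  · have h := hdiv.2 hζ.toTestFunction
    have h' : ∫ x in (Ω : Set Plane), fderiv ℝ ζ x (entropySigma e₁ e₂ (g' x)) = 0 := h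
    rw [setIntegral_eq_integral_of_ae hΩm
      (g := fun x => 1 / 6 * along (3 * conj (m x) + m x ^ 3) ζ x) ?_
      fun x hx => by rw [hζ.along_eq_zero hx, mul_zero]] at h'
    · rw [integral_const_mul] at h'
      exact (mul_eq_zero.1 h').resolve_left (by norm_num)
    · filter_upwards [hmg'] with x hx hxΩ
      rw [fderiv_apply_eq_along, toComplex_entropySigma_e (hx hxΩ).2, along_smul, (hx hxΩ).1]
  · have h := hdiv'.2 hζ.toTestFunction
    have h' : ∫ x in (Ω : Set Plane), fderiv ℝ ζ x (entropySigma ε₁ ε₂ (g' x)) = 0 := h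
    rw [setIntegral_eq_integral_of_ae hΩm
      (g := fun x => 1 / 6 * along (Complex.I * (3 * conj (m x) - m x ^ 3)) ζ x) ?_
      fun x hx => by rw [hζ.along_eq_zero hx, mul_zero]] at h'
    · rw [integral_const_mul] at h'
      exact (mul_eq_zero.1 h').resolve_left (by norm_num)
    · filter_upwards [hmg'] with x hx hxΩ
      rw [fderiv_apply_eq_along, toComplex_entropySigma_ε (hx hxΩ).2, along_smul, (hx hxΩ).1]
  · filter_upwards [hmg', hg'.ae_eq hg] with x h1 h2 hx
    rw [(h1 hx).1, h2 hx]

theorem inner_perp (p ξ : Plane) : ⟪perp p, ξ⟫ = rotCoord (toComplex ξ) (toComplex p) := by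
  simp [inner_plane, perp, rotCoord, toComplex]
  ring

theorem norm_perp (p : Plane) : ‖perp p‖ = ‖p‖ := by
  rw [EuclideanSpace.norm_eq, EuclideanSpace.norm_eq, Fin.sum_univ_two, Fin.sum_univ_two]
  simp [perp, add_comm]

end EikonalEntropy

end

theorem mainTheorem6 (Ω : TopologicalSpace.Opens EikonalEntropy.Plane)
    (hΩb : Bornology.IsBounded (Ω : Set EikonalEntropy.Plane))
    (hΩs : IsSimplyConnected (Ω : Set EikonalEntropy.Plane))
    (u : EikonalEntropy.Plane → ℝ) (hu : u ∈ EikonalEntropy.E Ω)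
    (gradu : EikonalEntropy.Plane → EikonalEntropy.Plane)
    (hgradu : EikonalEntropy.IsWeakGradient Ω u gradu)
    (ξ : EikonalEntropy.Plane)
    (hξ : ξ ∈ Metric.sphere (0 : EikonalEntropy.Plane) 1 \
      {EikonalEntropy.e₁, -EikonalEntropy.e₁, EikonalEntropy.e₂, -EikonalEntropy.e₂}) :
    EikonalEntropy.IsDivergenceFree Ω
        (fun x => EikonalEntropy.Φ ξ (EikonalEntropy.perp (gradu x))) ∧
      EikonalEntropy.IsConstantAlong Ω ξ
        (fun x => EikonalEntropy.χ (fun y => EikonalEntropy.perp (gradu y)) x ξ) := by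
  open EikonalEntropy in
  obtain ⟨m, hm, hmg⟩ := exists_isEikonal hu hgradu
  have hΩm : MeasurableSet (Ω : Set Plane) := Ω.isOpen.measurableSet
  have hc : ‖toComplex ξ‖ = 1 := by
    rw [norm_toComplex]; simpa using hξ.1
  set f : Plane → ℝ := fun x => if 0 < rotCoord (toComplex ξ) (m x) then 1 else 0 with hf
  have hfm : Measurable f :=
    Measurable.ite (((continuous_rotCoord _).measurable.comp hm.measurable) measurableSet_Ioi)
      measurable_const measurable_const
  have hfI : IntegrableOn f (Ω : Set Plane) :=
    Measure.integrableOn_of_bounded (M := 1) hΩb.measure_lt_top.ne hfm.aestronglyMeasurable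
      (Filter.Eventually.of_forall fun x => by simp only [hf]; split_ifs <;> simp)
  have hχ : ∀ᵐ x, x ∈ (Ω : Set Plane) → χ (fun y => perp (gradu y)) x ξ = f x := by
    filter_upwards [hmg] with x hx hxΩ
    simp only [χ, hf, inner_perp, hx hxΩ]
  have hΦ : ∀ᵐ x, x ∈ (Ω : Set Plane) → Φ ξ (perp (gradu x)) = f x • ξ := by
    filter_upwards [hmg] with x hx hxΩ
    have h1 : ‖gradu x‖ = 1 := by
      rw [← norm_toComplex, ← hx hxΩ, hm.norm_eq_one]
    simp only [Φ, hf, inner_perp, hx hxΩ, norm_perp, h1]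
    split_ifs <;> simp
  have key : ∀ ζ : TestFunction Ω ℝ ⊤, ∫ x, f x * fderiv ℝ ζ x ξ = 0 := by
    intro ζ
    simp only [fderiv_apply_eq_along]
    exact hm.integral_indicator_along Ω.isOpen (isTest_testFunction ζ) hc
  refine ⟨⟨?_, fun ζ => ?_⟩, ?_, fun ζ => ?_⟩
  · refine IntegrableOn.locallyIntegrableOn ?_
    exact (hfI.smul_const ξ).congr ((ae_restrict_iff' hΩm).2 (by
      filter_upwards [hΦ] with x hx hxΩ
      exact (hx hxΩ).symm))
  · rw [setIntegral_eq_integral_of_ae hΩm (g := fun x => f x * fderiv ℝ ζ x ξ) ?_ ?_, key]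
    · filter_upwards [hΦ] with x hx hxΩ
      rw [hx hxΩ, map_smul, smul_eq_mul]
    · intro x hx
      rw [(isTest_testFunction ζ).fderiv_eq_zero hx]
      simp
  · refine IntegrableOn.locallyIntegrableOn ?_
    exact hfI.congr ((ae_restrict_iff' hΩm).2 (by
      filter_upwards [hχ] with x hx hxΩ
      exact (hx hxΩ).symm))
  · rw [setIntegral_eq_integral_of_ae hΩm (g := fun x => f x * fderiv ℝ ζ x ξ) ?_ ?_, key]
    · filter_upwards [hχ] with x hx hxΩ
      rw [hx hxΩ]
    · intro x hx
      rw [(isTest_testFunction ζ).fderiv_eq_zero hx]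
      simp
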